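/- All systems are finite-dimensional. For an integer $d\ge 2$, the $d$-dimensional Werner--Holevo channel is $$\mathcal W^{(d,1)}(X)=\frac{1}{d-1}\left(\mathbb 1\,\mathrm{Tr}X-X^{\mathrm T}\right).$$ A *forward-assisted code of size $K$* for channels with input $A'$ and output $B$ consists of channels (completely positive trace-preserving maps) $\mathcal E:A\to A'Q$, $\mathcal F:Q\to R$ and $\mathcal D:BR\to B'$, where $\dim A=\dim B'=K$ and $Q,R$ are arbitrary. Applied to a channel $\mathcal N:A'\to B$, it gives the operation $\mathcal M=\mathcal D\mathcal F\mathcal N\mathcal E:A\to B'$, whose channel fidelity is $\mathrm{Tr}\,\phi\,(\mathcal M\otimes\mathrm{id})(\phi)$ with $\phi$ the maximally entangled state of two $K$-dimensional systems. The code is *PPT-preserving* if its bipartite operation $\mathcal Z=\mathcal D\mathcal F\mathcal E:AB\to A'B'$ (Alice holds $A,A'$; Bob holds $B,B'$) is, i.e. if for all additional systems $\tilde A$ of Alice and $\tilde B$ of Bob, $\mathcal Z\otimes\mathrm{id}_{\tilde A\tilde B}$ maps every state on $A\tilde A:B\tilde B$ with positive semidefinite partial transpose to an operator on $A'\tilde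 A:B'\tilde B$ with positive semidefinite partial transpose. Let $F^{\mathbf{PPTp}}(\mathcal N,K)$ be the maximum channel fidelity attainable with PPT-preserving codes of size $K$ applied to $\mathcal N$, and let $$Q^{\mathbf{PPTp}}(\mathcal N)=\sup\{r:\lim_{n\to\infty}F^{\mathbf{PPTp}}(\mathcal N^{\otimes n},\lfloor 2^{rn}\rfloor)=1\},$$ $$Q_0^{\mathbf{PPTp}}(\mathcal N)=\sup_{n\ge 1}\max\left\{\tfrac1n\log_2K: F^{\mathbf{PPTp}}(\mathcal N^{\otimes n},K)=1\right\}.$$ Then, for every integer $d\ge 2$, $$Q^{\mathbf{PPTp}}(\mathcal W^{(d,1)})=Q_0^{\mathbf{PPTp}}(\mathcal W^{(d,1)})=\log_2\frac{d+2}{d}.$$ -/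

import Mathlib

open scoped ComplexOrder Kronecker

noncomputable section

namespace QCode

/-! A finite-dimensional quantum system is given by a finite index type `ι` (its computational
basis); operators on it are matrices in `Matrix ι ι ℂ`, and a composite system has the product
index type. -/

/-- Linear maps from operators on the system `ι` to operators on the system `κ`. -/
abbrev OpMap (ι κ : Type) : Type := Matrix ι ι ℂ →ₗ[ℂ] Matrix κ κ ℂ

/-- The tensor product `N ⊗ M` of two maps on operators, expressed through matrix units:
it is the linear map that sends `X ⊗ₖ Y` to `N X ⊗ₖ M Y`, see `tensorMap_kronecker`. -/
def tensorMap {ι κ ι' κ' : Type} [Fintype ι] [DecidableEq ι] [Fintype ι'] [DecidableEq ι']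
    (N : OpMap ι κ) (M : OpMap ι' κ') : OpMap (ι × ι') (κ × κ') where
  toFun X := Matrix.of fun k l => ∑ i : ι × ι', ∑ j : ι × ι',
    N (Matrix.single i.1 j.1 1) k.1 l.1 * M (Matrix.single i.2 j.2 1) k.2 l.2 * X i j
  map_add' X Y := by
    ext k l
    simp only [Matrix.of_apply, Matrix.add_apply, mul_add, Finset.sum_add_distrib]
  map_smul' c X := by
    ext k l
    simp only [Matrix.of_apply, Matrix.smul_apply, smul_eq_mul, RingHom.id_apply, Finset.mul_sum]
    refine Finset.sum_congr rfl fun i _ => Finset.sum_congr rfl fun j _ => ?_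
    ring

/-- The `n`-fold tensor power `N ⊗ ⋯ ⊗ N`; the system of `n` copies of `ι` has the index type
`Fin n → ι`.  On product operators see `tensorPow_product`. -/
def tensorPow {ι κ : Type} [Fintype ι] [DecidableEq ι] (N : OpMap ι κ) (n : ℕ) :
    OpMap (Fin n → ι) (Fin n → κ) where
  toFun X := Matrix.of fun k l => ∑ i : Fin n → ι, ∑ j : Fin n → ι,
    (∏ t : Fin n, N (Matrix.single (i t) (j t) 1) (k t) (l t)) * X i j
  map_add' X Y := by
    ext k l
    simp only [Matrix.of_apply, Matrix.add_apply, mul_add, Finset.sum_add_distrib]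
  map_smul' c X := by
    ext k l
    simp only [Matrix.of_apply, Matrix.smul_apply, smul_eq_mul, RingHom.id_apply, Finset.mul_sum]
    refine Finset.sum_congr rfl fun i _ => Finset.sum_congr rfl fun j _ => ?_
    ring

theorem opMap_apply_eq_sum {ι κ : Type} [Fintype ι] [DecidableEq ι] (N : OpMap ι κ)
    (X : Matrix ι ι ℂ) (k l : κ) :
    N X k l = ∑ i : ι, ∑ j : ι, N (Matrix.single i j 1) k l * X i j := by
  have h : N X = ∑ i : ι, ∑ j : ι, X i j • N (Matrix.single i j 1) := by
    conv_lhs => rw [Matrix.matrix_eq_sum_single X]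
    simp only [map_sum]
    refine Finset.sum_congr rfl fun i _ => Finset.sum_congr rfl fun j _ => ?_
    rw [← map_smul, Matrix.smul_single, smul_eq_mul, mul_one]
  rw [h]
  simp only [Matrix.sum_apply, Matrix.smul_apply, smul_eq_mul, mul_comm]

theorem tensorMap_kronecker {ι κ ι' κ' : Type} [Fintype ι] [DecidableEq ι] [Fintype ι']
    [DecidableEq ι'] (N : OpMap ι κ) (M : OpMap ι' κ') (X : Matrix ι ι ℂ) (Y : Matrix ι' ι' ℂ) :
    tensorMap N M (X ⊗ₖ Y) = N X ⊗ₖ M Y := by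
  ext k l
  simp only [Matrix.kroneckerMap_apply, opMap_apply_eq_sum N X, opMap_apply_eq_sum M Y]
  change (∑ i : ι × ι', ∑ j : ι × ι', N (Matrix.single i.1 j.1 1) k.1 l.1 *
    M (Matrix.single i.2 j.2 1) k.2 l.2 * (X i.1 j.1 * Y i.2 j.2)) = _
  simp only [Fintype.sum_prod_type, Finset.sum_mul_sum]
  refine Finset.sum_congr rfl fun i _ => Finset.sum_congr rfl fun i' _ =>
    Finset.sum_congr rfl fun j _ => Finset.sum_congr rfl fun j' _ => ?_
  ring

theorem tensorPow_product {ι κ : Type} [Fintype ι] [DecidableEq ι] (N : OpMap ι κ) (n : ℕ)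
    (X : Fin n → Matrix ι ι ℂ) (k l : Fin n → κ) :
    tensorPow N n (Matrix.of fun i j => ∏ t, X t (i t) (j t)) k l = ∏ t, N (X t) (k t) (l t) := by
  simp only [fun t => opMap_apply_eq_sum N (X t) (k t) (l t)]
  simp only [Finset.prod_univ_sum, Fintype.piFinset_univ]
  change (∑ i : Fin n → ι, ∑ j : Fin n → ι,
    (∏ t : Fin n, N (Matrix.single (i t) (j t) 1) (k t) (l t)) * ∏ t, X t (i t) (j t)) = _
  simp only [← Finset.prod_mul_distrib]

/-- Complete positivity: `N ⊗ id` preserves positive semidefiniteness for every finite-dimensional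
reference system. -/
def IsCompletelyPositive {ι κ : Type} [Fintype ι] [DecidableEq ι] (N : OpMap ι κ) : Prop :=
  ∀ (k : ℕ) (X : Matrix (ι × Fin k) (ι × Fin k) ℂ), X.PosSemidef →
    (tensorMap N (LinearMap.id : OpMap (Fin k) (Fin k)) X).PosSemidef

/-- A quantum operation (channel): a completely positive, trace-preserving linear map. -/
structure IsChannel {ι κ : Type} [Fintype ι] [DecidableEq ι] [Fintype κ] (N : OpMap ι κ) :
    Prop where
  completelyPositive : IsCompletelyPositive N
  tracePreserving : ∀ X : Matrix ι ι ℂ, (N X).trace = X.trace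

/-- Quantum states (density operators). -/
structure IsState {ι : Type} [Fintype ι] (ρ : Matrix ι ι ℂ) : Prop where
  posSemidef : ρ.PosSemidef
  trace_eq_one : ρ.trace = 1

/-- The partial transpose of a bipartite operator, on the second (Bob's) system. -/
def partialTranspose {P Q : Type} (X : Matrix (P × Q) (P × Q) ℂ) : Matrix (P × Q) (P × Q) ℂ :=
  Matrix.of fun x y => X (x.1, y.2) (y.1, x.2)

/-- A bipartite operator is PPT if its partial transpose is positive semidefinite. -/
def IsPPT {P Q : Type} (X : Matrix (P × Q) (P × Q) ℂ) : Prop :=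
  (partialTranspose X).PosSemidef

/-- Regroup an operator on `(A B)(Ã B̃)` along the Alice / Bob cut `(A Ã) : (B B̃)`. -/
def aliceBobCut {A B A₂ B₂ : Type} (X : Matrix ((A × B) × (A₂ × B₂)) ((A × B) × (A₂ × B₂)) ℂ) :
    Matrix ((A × A₂) × (B × B₂)) ((A × A₂) × (B × B₂)) ℂ :=
  Matrix.reindex (Equiv.prodProdProdComm A B A₂ B₂) (Equiv.prodProdProdComm A B A₂ B₂) X

/-- A bipartite map `A B → A' B'` is PPT-preserving if, in the presence of arbitrary further
systems `Ã` of Alice and `B̃` of Bob on which it acts trivially, it takes every state that is PPT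
with respect to the Alice / Bob partition to a PPT operator. -/
def IsPPTPreserving {A B A' B' : Type} [Fintype A] [DecidableEq A] [Fintype B] [DecidableEq B]
    (Z : OpMap (A × B) (A' × B')) : Prop :=
  ∀ (a b : ℕ) (ρ : Matrix ((A × B) × (Fin a × Fin b)) ((A × B) × (Fin a × Fin b)) ℂ),
    IsState ρ → IsPPT (aliceBobCut ρ) →
      IsPPT (aliceBobCut
        (tensorMap Z (LinearMap.id : OpMap (Fin a × Fin b) (Fin a × Fin b)) ρ))

/-- A forward-assisted code of size `K` for channels with input system `A'` and output system `B`: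
Alice's encoder `A → A' Q`, a side channel `Q → R` of arbitrary finite dimensions, and Bob's
decoder `B R → B'`, where `dim A = dim B' = K`. -/
structure ForwardAssistedCode (A' B : Type) [Fintype A'] [DecidableEq A'] [Fintype B]
    [DecidableEq B] (K : ℕ) where
  dimQ : ℕ
  dimR : ℕ
  encoder : OpMap (Fin K) (A' × Fin dimQ)
  side : OpMap (Fin dimQ) (Fin dimR)
  decoder : OpMap (B × Fin dimR) (Fin K)
  encoder_isChannel : IsChannel encoder
  side_isChannel : IsChannel side
  decoder_isChannel : IsChannel decoder

namespace ForwardAssistedCode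

variable {A' B : Type} [Fintype A'] [DecidableEq A'] [Fintype B] [DecidableEq B] {K : ℕ}

/-- Bob's part together with the side channel, `D ∘ (id_B ⊗ F) : B Q → B'`. -/
def receiver (C : ForwardAssistedCode A' B K) : OpMap (B × Fin C.dimQ) (Fin K) :=
  C.decoder ∘ₗ tensorMap (LinearMap.id : OpMap B B) C.side

/-- The overall operation `M = D F N E : A → B'` that results from using the code on `N`. -/
def overall (C : ForwardAssistedCode A' B K) (N : OpMap A' B) : OpMap (Fin K) (Fin K) :=
  C.receiver ∘ₗ tensorMap N (LinearMap.id : OpMap (Fin C.dimQ) (Fin C.dimQ)) ∘ₗ C.encoder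

/-- The bijection `(A' Q) B ≃ A' (B Q)` of composite systems. -/
def regroup (A' B Q : Type) : (A' × Q) × B ≃ A' × (B × Q) :=
  (Equiv.prodAssoc A' Q B).trans (Equiv.prodCongr (Equiv.refl A') (Equiv.prodComm Q B))

/-- The bipartite operation `Z = D F E : A B → A' B'` of the code, in which `A` and `A'` belong to
Alice and `B` and `B'` to Bob. -/
def bipartite (C : ForwardAssistedCode A' B K) : OpMap (Fin K × B) (A' × Fin K) :=
  tensorMap (LinearMap.id : OpMap A' A') C.receiver ∘ₗ
    (Matrix.reindexLinearEquiv ℂ ℂ (regroup A' B (Fin C.dimQ))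
      (regroup A' B (Fin C.dimQ))).toLinearMap ∘ₗ
    tensorMap C.encoder (LinearMap.id : OpMap B B)

end ForwardAssistedCode

/-- The maximally entangled state `φ` of two `K`-dimensional systems. -/
def maxEntangled (K : ℕ) : Matrix (Fin K × Fin K) (Fin K × Fin K) ℂ :=
  Matrix.of fun x y => if x.1 = x.2 ∧ y.1 = y.2 then (1 / K : ℂ) else 0

/-- The channel fidelity `Tr φ (M ⊗ id) φ`. -/
def channelFidelity {K : ℕ} (M : OpMap (Fin K) (Fin K)) : ℝ :=
  (maxEntangled K *
    tensorMap M (LinearMap.id : OpMap (Fin K) (Fin K)) (maxEntangled K)).trace.re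

/-- The channel fidelities obtained by applying PPT-preserving (forward-assisted) codes of size `K`
to the channel `N`. -/
def pptFidelities {A' B : Type} [Fintype A'] [DecidableEq A'] [Fintype B] [DecidableEq B]
    (N : OpMap A' B) (K : ℕ) : Set ℝ :=
  {f | ∃ C : ForwardAssistedCode A' B K,
    IsPPTPreserving C.bipartite ∧ f = channelFidelity (C.overall N)}

/-- The optimal channel fidelity of PPT-preserving codes of size `K` for `N`. -/
def optPPTFidelity {A' B : Type} [Fintype A'] [DecidableEq A'] [Fintype B] [DecidableEq B]
    (N : OpMap A' B) (K : ℕ) : ℝ :=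
  sSup (pptFidelities N K)

/-- The quantum capacity of PPT-preserving codes over the memoryless channel given by `N`: the
supremum of the rates `r` for which the optimal fidelity at size `⌊2 ^ (r n)⌋` over `n` uses tends
to one.  The supremum is taken in the extended reals. -/
def pptCapacity {A' B : Type} [Fintype A'] [DecidableEq A'] [Fintype B] [DecidableEq B]
    (N : OpMap A' B) : EReal :=
  ⨆ (r : ℝ) (_ : Filter.Tendsto
    (fun n : ℕ => optPPTFidelity (tensorPow N n) ⌊(2 : ℝ) ^ (r * n)⌋₊) Filter.atTop (nhds 1)),
      (r : EReal)

/-- The zero-error quantum capacity of PPT-preserving codes over the memoryless channel given by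
`N`: the supremum of `(1 / n) log₂ K` over all `n ≥ 1` and all `K` such that the maximum channel
fidelity of PPT-preserving codes of size `K` over `n` uses is (attained and) equal to one. -/
def pptZeroErrorCapacity {A' B : Type} [Fintype A'] [DecidableEq A'] [Fintype B] [DecidableEq B]
    (N : OpMap A' B) : EReal :=
  ⨆ (n : ℕ) (_ : 1 ≤ n) (K : ℕ) (_ : IsGreatest (pptFidelities (tensorPow N n) K) 1),
    ((1 / n * Real.logb 2 K : ℝ) : EReal)

/-- The `d`-dimensional Werner–Holevo channel `X ↦ (1 / (d - 1)) (Tr X • 1 - Xᵀ)`. -/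
def wernerHolevo (d : ℕ) : OpMap (Fin d) (Fin d) where
  toFun X := (1 / ((d : ℂ) - 1)) • (X.trace • (1 : Matrix (Fin d) (Fin d) ℂ) - X.transpose)
  map_add' X Y := by
    rw [Matrix.trace_add, Matrix.transpose_add, add_smul, ← smul_add]
    congr 1
    abel
  map_smul' c X := by
    rw [Matrix.trace_smul, Matrix.transpose_smul, smul_assoc, ← smul_sub, RingHom.id_apply,
      smul_comm]

end QCode

end

set_option linter.unusedSectionVars false

namespace QCode

/-! Everything is expressed through Choi matrices. Write `J` for the Choi matrix of the channel, `Γ`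
for partial transposition on Bob's side, `F` for the swap and `Φ` for the maximally entangled
projection, so that `F^Γ = d Φ`. A bipartite operation is PPT-preserving exactly when the partial
transpose of its Choi matrix is positive semidefinite (with nonempty input systems for the
necessity), and the fidelity of a code is a linear functional of the Choi matrix of that operation.

Converse (`channelFidelity_overall_le`): if `S ± J^Γ ≥ 0` and the partial trace of `S` over Bob is
`c 1`, then `S ⊗ 1 - J^Γ ⊗ F ≥ 0`, where `F` acts on `A B'`. Pair this with the partially transposed
Choi matrix of a code: the second term gives `K²` times the fidelity, and the first gives `c K`,
because Bob cannot signal to Alice. Hence the fidelity is at most `c / K`.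

Achievability (`isGreatest_pptFidelities`): Alice sends her system and half of a maximally entangled
pair through the side channel, and the other half through the noisy channel. Bob measures `{L, 1 -
L}`, applies the identity channel on acceptance and the channel orthogonal to it on rejection. This
code is PPT-preserving when `-1 ≤ K L^Γ ≤ 1`, and it is exact when `L` accepts the Choi state with
certainty.

For the Werner–Holevo channel the two bounds meet. Here `J^Γ = (1 - Φ)/(d - 1) - Φ`, and `S = |J^Γ|`
has partial trace `(d + 2)/d`. On the other side, `L = (d 1 - 2 F)/(d + 2)` is `1` on the
antisymmetric space and `L^Γ = (d/(d + 2)) (1 - 2 Φ)`. Both certificates are stable under tensor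
powers (`posSemidef_tensorPower_add_add_smul`), so over `n` uses the fidelity is at most `((d +
2)/d)^n / K`, and it is `1` whenever `2 ≤ K ≤ ((d + 2)/d)^n`. Rounding `K` to an integer costs
nothing asymptotically. -/

/-! ### Positive semidefinite matrices, Hadamard and link products -/

theorem posSemidef_of_eq {ι : Type} {X Y : Matrix ι ι ℂ} (hX : X.PosSemidef)
    (h : ∀ x y, Y x y = X x y) : Y.PosSemidef := by
  have : Y = X := Matrix.ext h
  rwa [this]

theorem posSemidef_hadamard {ι : Type} [Fintype ι] {X Y : Matrix ι ι ℂ}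
    (hX : X.PosSemidef) (hY : Y.PosSemidef) : (X.hadamard Y).PosSemidef :=
  hX.hadamard hY

/-- Contracting the common index of two positive semidefinite matrices (the link product)
gives a positive semidefinite matrix. -/
theorem posSemidef_link {ι κ α : Type} [Fintype ι] [Fintype κ] [Fintype α]
    {C : Matrix (ι × κ) (ι × κ) ℂ} {X : Matrix (ι × α) (ι × α) ℂ}
    (hC : C.PosSemidef) (hX : X.PosSemidef) :
    (Matrix.of fun x y : κ × α =>
      ∑ i, ∑ j, C (i, x.1) (j, y.1) * X (i, x.2) (j, y.2)).PosSemidef := by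
  classical
  -- The tensor product of two operators is the Hadamard product of their pullbacks. Keeping a
  -- single copy of the index `ι` in it and compressing by the map that sums over `ι` gives the
  -- contraction.
  have h := (posSemidef_hadamard (hC.submatrix fun x : ι × (κ × α) => (x.1, x.2.1))
    (hX.submatrix fun x : ι × (κ × α) => (x.1, x.2.2))).conjTranspose_mul_mul_same
      (Matrix.of fun (x : ι × (κ × α)) (y : κ × α) => if x.2 = y then (1 : ℂ) else 0)
  refine posSemidef_of_eq h fun x y => ?_
  simp only [Matrix.mul_apply, Matrix.conjTranspose_apply, Matrix.of_apply, Matrix.hadamard_apply,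
    Matrix.submatrix_apply, apply_ite (star : ℂ → ℂ), star_one, star_zero, ite_mul, one_mul,
    zero_mul, mul_ite, mul_one, mul_zero]
  rw [Fintype.sum_prod_type]
  simp only [Finset.sum_ite_eq', Finset.mem_univ, if_true]
  simp only [Fintype.sum_prod_type (f := fun z : ι × (κ × α) => ite (z.2 = x) _ _)]
  simp only [Finset.sum_ite_eq', Finset.mem_univ, if_true]
  exact Finset.sum_comm

theorem posSemidef_sum_mul_nonneg {ι : Type} [Fintype ι] {X Y : Matrix ι ι ℂ}
    (hX : X.PosSemidef) (hY : Y.PosSemidef) : 0 ≤ ∑ i, ∑ j, X i j * Y i j := by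
  have h := (posSemidef_hadamard hX hY).dotProduct_mulVec_nonneg 1
  simpa [dotProduct, Matrix.mulVec] using h

/-- The matrix with entries `v x * star (v y)`. -/
theorem posSemidef_of_mul_star {ι : Type} [Fintype ι] (v : ι → ℂ) :
    (Matrix.of fun x y => v x * star (v y)).PosSemidef :=
  Matrix.posSemidef_vecMulVec_self_star v

theorem posSemidef_of_ite_and {ι : Type} [Fintype ι] (p : ι → Prop) [DecidablePred p] :
    (Matrix.of fun x y => if p x ∧ p y then (1 : ℂ) else 0).PosSemidef := by
  convert posSemidef_of_mul_star fun x => if p x then (1 : ℂ) else 0 using 4 with x y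
  by_cases hx : p x <;> by_cases hy : p y <;> simp [hx, hy]

/-! ### Choi matrices of maps and channels -/

section Choi

variable {ι κ ι' κ' μ : Type} [Fintype ι] [DecidableEq ι] [Fintype ι'] [DecidableEq ι']
  [Fintype κ] [DecidableEq κ] [Fintype κ'] [DecidableEq κ'] [Fintype μ] [DecidableEq μ]

/-- The (unnormalised) Choi matrix of a map on operators. -/
def choi {ι κ : Type} [DecidableEq ι] (N : OpMap ι κ) : Matrix (ι × κ) (ι × κ) ℂ :=
  Matrix.of fun x y => N (Matrix.single x.1 y.1 1) x.2 y.2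

/-- The map on operators with a given Choi matrix. -/
def ofChoi {ι κ : Type} [Fintype ι] (C : Matrix (ι × κ) (ι × κ) ℂ) : OpMap ι κ where
  toFun X := Matrix.of fun k l => ∑ i, ∑ j, C (i, k) (j, l) * X i j
  map_add' X Y := by
    ext k l
    simp only [Matrix.of_apply, Matrix.add_apply, mul_add, Finset.sum_add_distrib]
  map_smul' c X := by
    ext k l
    simp only [Matrix.of_apply, Matrix.smul_apply, smul_eq_mul, RingHom.id_apply, Finset.mul_sum]
    refine Finset.sum_congr rfl fun i _ => Finset.sum_congr rfl fun j _ => ?_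
    ring

theorem apply_eq_sum_choi (N : OpMap ι κ) (X : Matrix ι ι ℂ) (k l : κ) :
    N X k l = ∑ i, ∑ j, choi N (i, k) (j, l) * X i j :=
  opMap_apply_eq_sum N X k l

theorem choi_ofChoi (C : Matrix (ι × κ) (ι × κ) ℂ) : choi (ofChoi C) = C := by
  ext ⟨i, k⟩ ⟨j, l⟩
  change ∑ i', ∑ j', C (i', k) (j', l) * Matrix.single i j 1 i' j' = _
  simp [Matrix.single_apply, ite_and]

theorem choi_id (x y : κ × κ) :
    choi (LinearMap.id : OpMap κ κ) x y = if x.1 = x.2 ∧ y.1 = y.2 then 1 else 0 :=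
  rfl

theorem choi_tensorMap (N : OpMap ι κ) (M : OpMap ι' κ') (x y : (ι × ι') × (κ × κ')) :
    choi (tensorMap N M) x y =
      choi N (x.1.1, x.2.1) (y.1.1, y.2.1) * choi M (x.1.2, x.2.2) (y.1.2, y.2.2) := by
  obtain ⟨⟨i, i'⟩, k, k'⟩ := x
  obtain ⟨⟨j, j'⟩, l, l'⟩ := y
  have : Matrix.single (i, i') (j, j') (1 : ℂ) = Matrix.single i j 1 ⊗ₖ Matrix.single i' j' 1 := by
    rw [Matrix.single_kronecker_single, one_mul]
  simp only [choi, Matrix.of_apply, this, tensorMap_kronecker, Matrix.kroneckerMap_apply]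

theorem choi_comp (M : OpMap κ μ) (N : OpMap ι κ) (x y : ι × μ) :
    choi (M ∘ₗ N) x y =
      ∑ k, ∑ l, choi M (k, x.2) (l, y.2) * choi N (x.1, k) (y.1, l) := by
  change M (N (Matrix.single x.1 y.1 1)) x.2 y.2 = _
  rw [apply_eq_sum_choi]
  rfl

theorem choi_tensorPow (N : OpMap ι κ) (n : ℕ) (x y : (Fin n → ι) × (Fin n → κ)) :
    choi (tensorPow N n) x y = ∏ t, choi N (x.1 t, x.2 t) (y.1 t, y.2 t) := by
  change (∑ i : Fin n → ι, ∑ j : Fin n → ι,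
    (∏ t : Fin n, N (Matrix.single (i t) (j t) 1) (x.2 t) (y.2 t)) *
      Matrix.single x.1 y.1 1 i j) = _
  simp [Matrix.single_apply, ite_and, choi]

theorem tensorMap_id_apply (N : OpMap ι κ) (X : Matrix (ι × ι') (ι × ι') ℂ) (x y : κ × ι') :
    tensorMap N (LinearMap.id : OpMap ι' ι') X x y =
      ∑ i, ∑ j, choi N (i, x.1) (j, y.1) * X (i, x.2) (j, y.2) := by
  rw [apply_eq_sum_choi]
  simp only [choi_tensorMap, choi_id, Fintype.sum_prod_type]
  simp [ite_and]

/-- Choi's theorem: applying the map to half of an unnormalised maximally entangled state yields the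
Choi matrix, and conversely `N ⊗ id` acts as a link product with it. -/
theorem isCompletelyPositive_iff (N : OpMap ι κ) :
    IsCompletelyPositive N ↔ (choi N).PosSemidef := by
  constructor
  · intro h
    let e := Fintype.equivFin ι
    have h1 := h (Fintype.card ι) _
      (posSemidef_of_ite_and fun x : ι × Fin (Fintype.card ι) => e x.1 = x.2)
    have h2 := h1.submatrix fun x : ι × κ => (x.2, e x.1)
    convert h2 using 1
    ext x y
    rw [Matrix.submatrix_apply, tensorMap_id_apply]
    simp [ite_and]
  · intro h k X hX
    convert posSemidef_link h hX using 1
    ext x y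
    rw [tensorMap_id_apply]
    rfl

theorem tracePreserving_iff (N : OpMap ι κ) :
    (∀ X : Matrix ι ι ℂ, (N X).trace = X.trace) ↔
      ∀ i j, ∑ k, choi N (i, k) (j, k) = if i = j then 1 else 0 := by
  constructor
  · intro h i j
    have h1 := h (Matrix.single i j 1)
    rw [Matrix.trace, Matrix.trace] at h1
    simpa [Matrix.single_apply, ite_and, choi, eq_comm] using h1
  · intro h X
    simp only [Matrix.trace, Matrix.diag_apply, apply_eq_sum_choi]
    rw [Finset.sum_comm]
    simp_rw [Finset.sum_comm (γ := κ), ← Finset.sum_mul, h]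
    simp

theorem isChannel_iff (N : OpMap ι κ) :
    IsChannel N ↔ (choi N).PosSemidef ∧
      ∀ i j, ∑ k, choi N (i, k) (j, k) = if i = j then 1 else 0 := by
  rw [← isCompletelyPositive_iff, ← tracePreserving_iff]
  exact ⟨fun h => ⟨h.1, h.2⟩, fun h => ⟨h.1, h.2⟩⟩

theorem isChannel_id : IsChannel (LinearMap.id : OpMap κ κ) := by
  rw [isChannel_iff]
  refine ⟨?_, fun i j => ?_⟩
  · exact posSemidef_of_ite_and fun x : κ × κ => x.1 = x.2
  · simp [choi_id, ite_and, eq_comm]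

theorem IsChannel.comp {M : OpMap κ μ} {N : OpMap ι κ} (hM : IsChannel M) (hN : IsChannel N) :
    IsChannel (M ∘ₗ N) := by
  refine ⟨?_, fun X => by simp [hM.2, hN.2]⟩
  rw [isCompletelyPositive_iff]
  have h := posSemidef_link ((isCompletelyPositive_iff _).1 hM.1)
    (((isCompletelyPositive_iff _).1 hN.1).submatrix (Equiv.prodComm κ ι))
  convert h.submatrix (Equiv.prodComm ι μ) using 1
  ext x y
  rw [choi_comp]
  rfl

theorem isChannel_tensorMap {N : OpMap ι κ} {M : OpMap ι' κ'} (hN : IsChannel N)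
    (hM : IsChannel M) : IsChannel (tensorMap N M) := by
  rw [isChannel_iff] at *
  refine ⟨?_, fun i j => ?_⟩
  · refine posSemidef_of_eq (posSemidef_hadamard
      (hN.1.submatrix fun x : (ι × ι') × (κ × κ') => (x.1.1, x.2.1))
      (hM.1.submatrix fun x : (ι × ι') × (κ × κ') => (x.1.2, x.2.2))) fun x y => ?_
    rw [choi_tensorMap]
    rfl
  · simp only [choi_tensorMap, Fintype.sum_prod_type, ← Finset.mul_sum, ← Finset.sum_mul,
      hN.2, hM.2]
    by_cases h1 : i.1 = j.1 <;> by_cases h2 : i.2 = j.2 <;> simp [h1, h2, Prod.ext_iff]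

theorem tensorMap_id_id :
    tensorMap (LinearMap.id : OpMap ι ι) (LinearMap.id : OpMap ι' ι') = LinearMap.id := by
  ext1 X
  ext x y
  rw [tensorMap_id_apply]
  simp [choi_id, ite_and]

end Choi

/-! ### Partial transposes of Choi matrices and PPT preservation -/

/-- Applied to an entrywise product, this is the invariance of the pairing of two bipartite
operators under partial transposition of both. -/
theorem sum_sum_swap_snd {A B M : Type} [Fintype A] [Fintype B] [AddCommMonoid M]
    (f : A × B → A × B → M) :
    ∑ x, ∑ y, f x y = ∑ x : A × B, ∑ y : A × B, f (x.1, y.2) (y.1, x.2) := by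
  simp only [Fintype.sum_prod_type]
  refine Finset.sum_congr rfl fun a _ => ?_
  rw [Finset.sum_comm]
  conv_rhs => rw [Finset.sum_comm]
  exact Finset.sum_congr rfl fun a' _ => Finset.sum_comm

theorem sum_reorder {A B Q M : Type} [Fintype A] [Fintype B] [Fintype Q] [AddCommMonoid M]
    (f : B → Q → B → Q → A → A → M) :
    ∑ b, ∑ q, ∑ b', ∑ q', ∑ a, ∑ a', f b q b' q' a a' =
      ∑ a, ∑ b, ∑ a', ∑ b', ∑ q, ∑ q', f b q b' q' a a' := by
  let e : B × Q × B × Q × A × A ≃ A × B × A × B × Q × Q :=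
    ⟨fun z => (z.2.2.2.2.1, z.1, z.2.2.2.2.2, z.2.2.1, z.2.1, z.2.2.2.1),
      fun z => (z.2.1, z.2.2.2.2.1, z.2.2.2.1, z.2.2.2.2.2, z.1, z.2.2.1),
      fun _ => rfl, fun _ => rfl⟩
  have h := Fintype.sum_equiv e
    (fun z => f z.1 z.2.1 z.2.2.1 z.2.2.2.1 z.2.2.2.2.1 z.2.2.2.2.2)
    (fun z => f z.2.1 z.2.2.2.2.1 z.2.2.2.1 z.2.2.2.2.2 z.1 z.2.2.1) fun _ => rfl
  simpa only [Fintype.sum_prod_type] using h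

section PPT

variable {A B A' B' : Type} [Fintype A] [DecidableEq A] [Fintype B] [DecidableEq B]
  [Fintype A'] [Fintype B']

/-- The Choi matrix of a bipartite map, partially transposed on Bob's input and output. -/
def choiPartialTranspose {A B A' B' : Type} [DecidableEq A] [DecidableEq B]
    (Z : OpMap (A × B) (A' × B')) : Matrix ((A × B) × (A' × B')) ((A × B) × (A' × B')) ℂ :=
  Matrix.of fun x y => choi Z ((x.1.1, y.1.2), (x.2.1, y.2.2)) ((y.1.1, x.1.2), (y.2.1, x.2.2))

/-- The partial transpose of the output is the link product of the partially transposed Choi matrix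
with the partial transpose of the input, so positivity of both suffices. -/
theorem isPPTPreserving_of_posSemidef {Z : OpMap (A × B) (A' × B')}
    (hZ : (choiPartialTranspose Z).PosSemidef) : IsPPTPreserving Z := by
  classical
  intro a b ρ _ hρ
  refine posSemidef_of_eq ((posSemidef_link hZ
    (Matrix.PosSemidef.submatrix hρ fun z : (A × B) × (Fin a × Fin b) =>
      ((z.1.1, z.2.1), (z.1.2, z.2.2)))).submatrix
    fun z : (A' × Fin a) × (B' × Fin b) => ((z.1.1, z.2.1), (z.1.2, z.2.2))) fun x y => ?_
  change tensorMap Z (LinearMap.id : OpMap (Fin a × Fin b) (Fin a × Fin b)) ρ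
    ((x.1.1, y.2.1), (x.1.2, y.2.2)) ((y.1.1, x.2.1), (y.1.2, x.2.2)) = _
  rw [tensorMap_id_apply, sum_sum_swap_snd]
  rfl

/-- Alice and Bob each hold a maximally entangled state of their input with a local reference. The
joint state is a product across the cut, hence PPT, and the image under the map is the normalised
Choi matrix. -/
theorem IsPPTPreserving.posSemidef [Nonempty A] [Nonempty B] {Z : OpMap (A × B) (A' × B')}
    (hZ : IsPPTPreserving Z) : (choiPartialTranspose Z).PosSemidef := by
  classical
  let e := Fintype.equivFin A
  let f := Fintype.equivFin B
  let c : ℂ := Fintype.card A * Fintype.card B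
  have hc : 0 < c := by
    have h1 : 0 < Fintype.card A := Fintype.card_pos
    have h2 : 0 < Fintype.card B := Fintype.card_pos
    have : 0 < ((Fintype.card A * Fintype.card B : ℕ) : ℂ) := by exact_mod_cast Nat.mul_pos h1 h2
    simpa [c] using this
  have hc' : 0 ≤ c⁻¹ := by simpa using hc.le
  let p : (A × B) × (Fin (Fintype.card A) × Fin (Fintype.card B)) → Prop :=
    fun x => e x.1.1 = x.2.1 ∧ f x.1.2 = x.2.2
  let p' : (A × Fin (Fintype.card A)) × (B × Fin (Fintype.card B)) → Prop :=
    fun x => e x.1.1 = x.1.2 ∧ f x.2.1 = x.2.2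
  let ρ := c⁻¹ • Matrix.of fun x y => if p x ∧ p y then (1 : ℂ) else 0
  have h1 : IsState ρ := by
    refine ⟨(posSemidef_of_ite_and p).smul hc', ?_⟩
    rw [Matrix.trace_smul]
    have : (Matrix.of fun x y => if p x ∧ p y then (1 : ℂ) else 0).trace = c := by
      simp [Matrix.trace, p, Fintype.sum_prod_type, ite_and, c]
    rw [this, smul_eq_mul, inv_mul_cancel₀ hc.ne']
  -- Partial transposition exchanges Bob's condition between row and column, which leaves the
  -- conjunction of all four conditions unchanged.
  have h2 : IsPPT (aliceBobCut ρ) := by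
    refine posSemidef_of_eq ((posSemidef_of_ite_and p').smul hc') fun x y => ?_
    change c⁻¹ * (if _ then _ else _) = c⁻¹ * (if _ then _ else _)
    congr 2
    simp only [p, p', Equiv.prodProdProdComm_symm, Equiv.prodProdProdComm_apply, eq_iff_iff]
    tauto
  have h3 := ((hZ _ _ ρ h1 h2).submatrix fun z : (A × B) × (A' × B') =>
    ((z.2.1, e z.1.1), (z.2.2, f z.1.2))).smul hc.le
  refine posSemidef_of_eq h3 fun x y => ?_
  change _ = c * tensorMap Z LinearMap.id ρ
    ((x.2.1, y.2.2), (e x.1.1, f y.1.2)) ((y.2.1, x.2.2), (e y.1.1, f x.1.2))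
  rw [tensorMap_id_apply]
  have h4 : ∀ x y, ρ x y = c⁻¹ * if p x ∧ p y then 1 else 0 := fun _ _ => rfl
  simp only [h4, p]
  simp only [EmbeddingLike.apply_eq_iff_eq, mul_ite, mul_one, mul_zero, ite_and,
    Fintype.sum_prod_type, Finset.sum_ite_eq', Finset.mem_univ, if_true, Finset.sum_ite_irrel,
    Finset.sum_const_zero]
  rw [mul_comm, mul_assoc, inv_mul_cancel₀ hc.ne', mul_one]
  rfl

end PPT

/-! ### Channel fidelity -/

theorem channelFidelity_eq {K : ℕ} (M : OpMap (Fin K) (Fin K)) :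
    channelFidelity M = (1 / K ^ 2 * ∑ i, ∑ j, choi M (i, i) (j, j) : ℂ).re := by
  unfold channelFidelity
  congr 1
  simp only [Matrix.trace, Matrix.diag_apply, Matrix.mul_apply, tensorMap_id_apply, maxEntangled,
    Matrix.of_apply, Fintype.sum_prod_type, ite_and, mul_ite, mul_zero, ite_mul, zero_mul,
    Finset.sum_ite_eq', Finset.sum_ite_eq, Finset.mem_univ, if_true, Finset.sum_ite_irrel,
    Finset.sum_const_zero]
  rw [Finset.sum_comm]
  simp only [Finset.mul_sum]
  refine Finset.sum_congr rfl fun i _ => Finset.sum_congr rfl fun j _ => ?_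
  ring

/-- The unnormalised entangled operator squares to `K` times itself, so this matrix `X` satisfies
`Xᴴ X = K X`. -/
theorem posSemidef_natCast_smul_one_sub (K : ℕ) :
    (Matrix.of fun x y : Fin K × Fin K =>
      (if x = y then (K : ℂ) else 0) - if x.1 = x.2 ∧ y.1 = y.2 then 1 else 0).PosSemidef := by
  obtain rfl | hK := K.eq_zero_or_pos
  · exact posSemidef_of_eq Matrix.PosSemidef.zero fun x => x.1.elim0
  have hK' : (K : ℂ) ≠ 0 := by exact_mod_cast hK.ne'
  have h := (Matrix.posSemidef_conjTranspose_mul_self (Matrix.of fun x y : Fin K × Fin K =>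
      (if x = y then (K : ℂ) else 0) - if x.1 = x.2 ∧ y.1 = y.2 then 1 else 0)).smul
      (a := (K : ℂ)⁻¹) (by simp)
  refine posSemidef_of_eq h fun x y => ?_
  rw [Matrix.smul_apply, smul_eq_mul, eq_inv_mul_iff_mul_eq₀ hK']
  simp only [Matrix.mul_apply, Matrix.conjTranspose_apply, Matrix.of_apply, star_sub,
    apply_ite (star : ℂ → ℂ), star_natCast, star_one, star_zero, mul_sub, sub_mul,
    Finset.sum_sub_distrib, ite_mul, mul_ite, zero_mul, mul_zero, mul_one, one_mul,
    Finset.sum_ite_eq', Finset.sum_ite_eq, Finset.mem_univ, if_true]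
  have hs : ∀ z : Fin K × Fin K,
      (∑ i, if z = (i, i) then (K : ℂ) else 0) = if z.1 = z.2 then (K : ℂ) else 0 := by
    intro z
    simp [Prod.ext_iff, ite_and, eq_comm]
  by_cases h1 : x.1 = x.2 <;> by_cases h2 : y.1 = y.2 <;> by_cases h3 : x = y <;>
    simp [h1, h2, h3, hs, Fintype.sum_prod_type, ite_and, eq_comm]

/-- Pair the Choi matrix, whose trace is `K`, with the positive operator of
`posSemidef_natCast_smul_one_sub`. -/
theorem channelFidelity_le_one {K : ℕ} {M : OpMap (Fin K) (Fin K)} (hM : IsChannel M) :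
    channelFidelity M ≤ 1 := by
  rw [channelFidelity_eq]
  rw [isChannel_iff] at hM
  obtain rfl | hK := K.eq_zero_or_pos
  · simp
  have h := posSemidef_sum_mul_nonneg hM.1 (posSemidef_natCast_smul_one_sub K)
  have h1 : ∑ x, ∑ y, choi M x y * (Matrix.of (fun x y : Fin K × Fin K =>
      (if x = y then (K : ℂ) else 0) - if x.1 = x.2 ∧ y.1 = y.2 then 1 else 0)) x y =
      K ^ 2 - ∑ i, ∑ j, choi M (i, i) (j, j) := by
    simp only [Matrix.of_apply, mul_sub, Finset.sum_sub_distrib, mul_ite, mul_zero, mul_one,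
      Finset.sum_ite_eq, Finset.mem_univ, if_true, ite_and, Fintype.sum_prod_type]
    simp only [← Finset.sum_mul, hM.2, if_true]
    simp [sq, Finset.sum_ite_irrel]
  rw [h1] at h
  have h2 := (Complex.le_def.1 h).1
  have h3 : (1 / K ^ 2 * ∑ i, ∑ j, choi M (i, i) (j, j) : ℂ).re =
      1 / (K : ℝ) ^ 2 * (∑ i, ∑ j, choi M (i, i) (j, j)).re := by
    rw [← Complex.re_ofReal_mul]
    push_cast
    rfl
  rw [h3, one_div, inv_mul_le_one₀ (by positivity)]
  have h4 : ((K : ℂ) ^ 2).re = (K : ℝ) ^ 2 := by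
    rw [← Complex.ofReal_natCast, ← Complex.ofReal_pow, Complex.ofReal_re]
  simp only [Complex.sub_re, Complex.zero_re, h4] at h2
  linarith

/-! ### Choi matrices of forward-assisted codes -/

namespace ForwardAssistedCode

variable {A' B : Type} [Fintype A'] [DecidableEq A'] [Fintype B] [DecidableEq B] {K : ℕ}

theorem isChannel_receiver (C : ForwardAssistedCode A' B K) : IsChannel C.receiver :=
  C.decoder_isChannel.comp (isChannel_tensorMap isChannel_id C.side_isChannel)

theorem isChannel_overall (C : ForwardAssistedCode A' B K) {N : OpMap A' B} (hN : IsChannel N) :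
    IsChannel (C.overall N) :=
  C.isChannel_receiver.comp ((isChannel_tensorMap hN isChannel_id).comp C.encoder_isChannel)

theorem choi_bipartite (C : ForwardAssistedCode A' B K) (x y : (Fin K × B) × (A' × Fin K)) :
    choi C.bipartite x y = ∑ q, ∑ q', choi C.receiver ((x.1.2, q), x.2.2) ((y.1.2, q'), y.2.2) *
      choi C.encoder (x.1.1, (x.2.1, q)) (y.1.1, (y.2.1, q')) := by
  unfold bipartite
  rw [choi_comp]
  have h : ∀ u v, choi ((Matrix.reindexLinearEquiv ℂ ℂ (regroup A' B (Fin C.dimQ))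
      (regroup A' B (Fin C.dimQ))).toLinearMap ∘ₗ
      tensorMap C.encoder (LinearMap.id : OpMap B B)) u v =
      choi (tensorMap C.encoder (LinearMap.id : OpMap B B))
        (u.1, ((u.2.1, u.2.2.2), u.2.2.1)) (v.1, ((v.2.1, v.2.2.2), v.2.2.1)) := fun _ _ => rfl
  simp only [h, choi_tensorMap, choi_id, Fintype.sum_prod_type, ite_and, mul_ite, mul_zero, ite_mul,
    zero_mul, mul_one, one_mul, Finset.sum_ite_eq', Finset.sum_ite_eq, Finset.mem_univ, if_true,
    Finset.sum_ite_irrel, Finset.sum_const_zero]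

/-- The code enters the overall operation only through its bipartite operation, contracted linearly
with the Choi matrix of the channel. -/
theorem choi_overall (C : ForwardAssistedCode A' B K) (N : OpMap A' B) (x y : Fin K × Fin K) :
    choi (C.overall N) x y = ∑ u : A' × B, ∑ v : A' × B, choi N u v *
      choi C.bipartite ((x.1, u.2), (u.1, x.2)) ((y.1, v.2), (v.1, y.2)) := by
  unfold overall
  simp only [choi_comp, choi_bipartite, choi_tensorMap, choi_id, Fintype.sum_prod_type, ite_and,
    mul_ite, mul_zero, ite_mul,
    zero_mul, mul_one, one_mul, Finset.sum_ite_eq', Finset.sum_ite_eq, Finset.mem_univ, if_true,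
    Finset.sum_ite_irrel, Finset.sum_const_zero, Finset.mul_sum]
  refine (sum_reorder fun b q b' q' a a' => choi C.receiver ((b, q), x.2) ((b', q'), y.2) *
    (choi N (a, b) (a', b') * choi C.encoder (x.1, a, q) (y.1, a', q'))).trans ?_
  refine Finset.sum_congr rfl fun _ _ => Finset.sum_congr rfl fun _ _ =>
    Finset.sum_congr rfl fun _ _ => Finset.sum_congr rfl fun _ _ =>
    Finset.sum_congr rfl fun _ _ => Finset.sum_congr rfl fun _ _ => ?_
  ring

theorem channelFidelity_overall (C : ForwardAssistedCode A' B K) (N : OpMap A' B) :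
    channelFidelity (C.overall N) = (1 / K ^ 2 * ∑ u : A' × B, ∑ v : A' × B, choi N u v *
      ∑ i, ∑ j, choi C.bipartite ((i, u.2), (u.1, i)) ((j, v.2), (v.1, j)) : ℂ).re := by
  rw [channelFidelity_eq]
  congr 2
  simp only [choi_overall, Finset.mul_sum]
  simp_rw [Finset.sum_comm (γ := A' × B) (α := Fin K)]

end ForwardAssistedCode

/-! ### Converse bound on the fidelity of PPT-preserving codes -/

/-- For a Hermitian involution, `(1 + U)² = 2 (1 + U)`. -/
theorem posSemidef_one_add_of_mul_self {ι : Type} [Fintype ι] [DecidableEq ι] {U : Matrix ι ι ℂ}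
    (hU : U.IsHermitian) (h : U * U = 1) : (1 + U).PosSemidef := by
  have h1 := (Matrix.posSemidef_conjTranspose_mul_self (1 + U)).smul (a := (2 : ℂ)⁻¹) (by simp)
  refine posSemidef_of_eq h1 fun x y => ?_
  rw [Matrix.conjTranspose_add, hU.eq, Matrix.conjTranspose_one, add_mul, mul_add, mul_add, h,
    mul_one, mul_one, one_mul, Matrix.smul_apply]
  simp only [Matrix.add_apply, smul_eq_mul]
  ring

theorem posSemidef_one_sub_of_mul_self {ι : Type} [Fintype ι] [DecidableEq ι] {U : Matrix ι ι ℂ}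
    (hU : U.IsHermitian) (h : U * U = 1) : (1 - U).PosSemidef := by
  rw [sub_eq_add_neg]
  exact posSemidef_one_add_of_mul_self hU.neg (by rw [neg_mul_neg, h])

/-- The operator that exchanges the two factors of `ι × ι`. -/
def swapMatrix (ι : Type) [DecidableEq ι] : Matrix (ι × ι) (ι × ι) ℂ :=
  Matrix.of fun x y => if x.1 = y.2 ∧ x.2 = y.1 then 1 else 0

theorem swapMatrix_apply {ι : Type} [DecidableEq ι] (x y : ι × ι) :
    swapMatrix ι x y = if x.1 = y.2 ∧ x.2 = y.1 then 1 else 0 :=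
  rfl

theorem isHermitian_swapMatrix (ι : Type) [DecidableEq ι] : (swapMatrix ι).IsHermitian := by
  ext x y
  simp only [swapMatrix, Matrix.conjTranspose_apply, Matrix.of_apply, apply_ite (star : ℂ → ℂ),
    star_one, star_zero]
  congr 1
  rw [eq_iff_iff]
  constructor <;> exact fun h => ⟨h.2.symm, h.1.symm⟩

theorem swapMatrix_mul_self (ι : Type) [Fintype ι] [DecidableEq ι] :
    swapMatrix ι * swapMatrix ι = 1 := by
  ext x y
  simp [swapMatrix, Matrix.mul_apply, Fintype.sum_prod_type, ite_and, Matrix.one_apply,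
    Prod.ext_iff]

namespace ForwardAssistedCode

variable {A' B : Type} [Fintype A'] [DecidableEq A'] [Fintype B] [DecidableEq B] {K : ℕ}

/-- Regrouping of the index of the Choi matrix of a bipartite map `A B → A' B'` as `A' B : A B'`. -/
def sumIndexEquiv (A' B : Type) (K : ℕ) :
    (A' × B) × (Fin K × Fin K) ≃ (Fin K × B) × (A' × Fin K) :=
  ⟨fun z => ((z.2.1, z.1.2), (z.1.1, z.2.2)), fun z => ((z.2.1, z.1.2), (z.1.1, z.2.2)),
    fun _ => rfl, fun _ => rfl⟩

/-- Bob cannot signal to Alice. -/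
theorem sum_choi_bipartite (C : ForwardAssistedCode A' B K) (i j : Fin K) (b b' : B) (a a' : A') :
    ∑ k, choi C.bipartite ((i, b), (a, k)) ((j, b'), (a', k)) =
      if b = b' then ∑ q, choi C.encoder (i, (a, q)) (j, (a', q)) else 0 := by
  simp only [choi_bipartite]
  rw [Finset.sum_comm]
  simp_rw [Finset.sum_comm (γ := Fin K), ← Finset.sum_mul,
    ((isChannel_iff _).1 C.isChannel_receiver).2, Prod.ext_iff]
  by_cases h : b = b' <;> simp [h]

theorem sum_sum_choi_encoder (C : ForwardAssistedCode A' B K) (i : Fin K) :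
    ∑ a, ∑ q, choi C.encoder (i, (a, q)) (i, (a, q)) = 1 := by
  have h := ((isChannel_iff _).1 C.encoder_isChannel).2 i i
  rwa [Fintype.sum_prod_type, if_pos rfl] at h

/-- Tracing out Bob's output forces his input indices to coincide, by no-signalling. What remains is
the partial trace of `S` over Bob, namely `c 1`, against an encoder of total trace `K`. -/
theorem sum_choiPartialTranspose_mul_one (C : ForwardAssistedCode A' B K)
    (S : Matrix (A' × B) (A' × B) ℂ) (c : ℂ)
    (hS : ∀ a a', ∑ b, S (a, b) (a', b) = if a = a' then c else 0) :
    ∑ x, ∑ y, choiPartialTranspose C.bipartite x y * (S (x.2.1, x.1.2) (y.2.1, y.1.2) *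
      (1 : Matrix (Fin K × Fin K) (Fin K × Fin K) ℂ) (x.1.1, x.2.2) (y.1.1, y.2.2)) = c * K := by
  have h1 : ∀ u v : A' × B, ∑ i, ∑ k, choi C.bipartite ((i, v.2), (u.1, k)) ((i, u.2), (v.1, k)) =
      if v.2 = u.2 then ∑ i, ∑ q, choi C.encoder (i, (u.1, q)) (i, (v.1, q)) else 0 := by
    intro u v
    simp only [sum_choi_bipartite, Finset.sum_ite_irrel, Finset.sum_const_zero]
  calc
    _ = ∑ u : A' × B, ∑ v : A' × B, S u v *
          ∑ i, ∑ k, choi C.bipartite ((i, v.2), (u.1, k)) ((i, u.2), (v.1, k)) := by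
      rw [← (sumIndexEquiv A' B K).sum_comp]
      simp_rw [← (sumIndexEquiv A' B K).sum_comp (fun y => choiPartialTranspose C.bipartite _ y * _)]
      rw [Fintype.sum_prod_type]
      refine Finset.sum_congr rfl fun u _ => ?_
      simp_rw [Fintype.sum_prod_type (f := fun y : (A' × B) × (Fin K × Fin K) => _ * _)]
      rw [Finset.sum_comm]
      refine Finset.sum_congr rfl fun v _ => ?_
      simp only [sumIndexEquiv, Equiv.coe_fn_mk, Matrix.one_apply, Prod.mk.eta, mul_ite, mul_one,
        mul_zero, Finset.sum_ite_eq, Finset.mem_univ, if_true]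
      rw [Fintype.sum_prod_type, Finset.mul_sum]
      refine Finset.sum_congr rfl fun i _ => ?_
      rw [Finset.mul_sum]
      exact Finset.sum_congr rfl fun k _ => mul_comm _ _
    _ = ∑ a, ∑ a', (∑ b, S (a, b) (a', b)) *
          ∑ i, ∑ q, choi C.encoder (i, (a, q)) (i, (a', q)) := by
      simp only [h1, Fintype.sum_prod_type, mul_ite, mul_zero, Finset.sum_ite_eq',
        Finset.mem_univ, if_true, Finset.sum_mul]
      exact Finset.sum_congr rfl fun a _ => Finset.sum_comm
    _ = c * K := by
      simp only [hS, ite_mul, zero_mul, Finset.sum_ite_eq, Finset.mem_univ, if_true]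
      rw [← Finset.mul_sum, Finset.sum_comm]
      simp only [sum_sum_choi_encoder]
      simp

/-- Undoing the partial transposition turns the swap into the unnormalised entangled operator, so
the pairing is `K²` times the fidelity before taking the real part. -/
theorem sum_choiPartialTranspose_mul_swap (C : ForwardAssistedCode A' B K) (N : OpMap A' B) :
    ∑ x, ∑ y, choiPartialTranspose C.bipartite x y *
      (partialTranspose (choi N) (x.2.1, x.1.2) (y.2.1, y.1.2) *
        swapMatrix (Fin K) (x.1.1, x.2.2) (y.1.1, y.2.2)) =
      ∑ u : A' × B, ∑ v : A' × B, choi N u v *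
        ∑ i, ∑ j, choi C.bipartite ((i, u.2), (u.1, i)) ((j, v.2), (v.1, j)) := by
  rw [sum_sum_swap_snd (A := A') (B := B), ← (sumIndexEquiv A' B K).sum_comp]
  simp_rw [← (sumIndexEquiv A' B K).sum_comp (fun y => choiPartialTranspose C.bipartite _ y * _)]
  rw [Fintype.sum_prod_type]
  refine Finset.sum_congr rfl fun u _ => ?_
  simp_rw [Fintype.sum_prod_type (f := fun y : (A' × B) × (Fin K × Fin K) => _ * _)]
  rw [Finset.sum_comm]
  refine Finset.sum_congr rfl fun v _ => ?_
  simp only [sumIndexEquiv, Equiv.coe_fn_mk, swapMatrix_apply, mul_ite, mul_one, mul_zero,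
    Fintype.sum_prod_type, ite_and, Finset.sum_ite_irrel, Finset.sum_const_zero,
    Finset.sum_ite_eq, Finset.sum_ite_eq', Finset.mem_univ, if_true, Finset.mul_sum]
  refine Finset.sum_congr rfl fun i _ => Finset.sum_congr rfl fun k _ => ?_
  rw [mul_comm]
  rfl

/-- Here `S` plays the role of `|J^Γ|` for the Choi matrix `J` of `N`, and `c` that of its partial
trace. -/
theorem channelFidelity_overall_le [Nonempty B] (hK : 0 < K) (C : ForwardAssistedCode A' B K)
    (hC : IsPPTPreserving C.bipartite) (N : OpMap A' B) (S : Matrix (A' × B) (A' × B) ℂ) (c : ℝ)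
    (h₁ : (S + partialTranspose (choi N)).PosSemidef)
    (h₂ : (S - partialTranspose (choi N)).PosSemidef)
    (hS : ∀ a a', ∑ b, S (a, b) (a', b) = if a = a' then (c : ℂ) else 0) :
    channelFidelity (C.overall N) ≤ c / K := by
  have : Nonempty (Fin K) := ⟨⟨0, hK⟩⟩
  let f : (Fin K × B) × (A' × Fin K) → A' × B := fun x => (x.2.1, x.1.2)
  let g : (Fin K × B) × (A' × Fin K) → Fin K × Fin K := fun x => (x.1.1, x.2.2)
  have hF := isHermitian_swapMatrix (Fin K)
  have hF' := swapMatrix_mul_self (Fin K)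
  -- With `T = J^Γ`, this is `(S - T) ⊗ (1 + F) + (S + T) ⊗ (1 - F) = 2 (S ⊗ 1 - T ⊗ F)`.
  have hT := (posSemidef_hadamard (h₂.submatrix f)
      ((posSemidef_one_add_of_mul_self hF hF').submatrix g)).add
    (posSemidef_hadamard (h₁.submatrix f) ((posSemidef_one_sub_of_mul_self hF hF').submatrix g))
  have hP := posSemidef_sum_mul_nonneg hC.posSemidef hT
  have key : ∑ x, ∑ y, choiPartialTranspose C.bipartite x y *
      (((S - partialTranspose (choi N)).submatrix f f).hadamard
          ((1 + swapMatrix (Fin K)).submatrix g g) +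
        ((S + partialTranspose (choi N)).submatrix f f).hadamard
          ((1 - swapMatrix (Fin K)).submatrix g g)) x y =
      2 * (c * K - ∑ u : A' × B, ∑ v : A' × B, choi N u v *
      ∑ i, ∑ j, choi C.bipartite ((i, u.2), (u.1, i)) ((j, v.2), (v.1, j))) := by
    rw [← C.sum_choiPartialTranspose_mul_one S c hS, ← C.sum_choiPartialTranspose_mul_swap N]
    simp only [← Finset.sum_sub_distrib, Finset.mul_sum, Matrix.add_apply, Matrix.hadamard_apply,
      Matrix.submatrix_apply, Matrix.sub_apply]
    refine Finset.sum_congr rfl fun x _ => Finset.sum_congr rfl fun y _ => ?_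
    ring
  rw [key] at hP
  rw [channelFidelity_overall]
  set z := ∑ u : A' × B, ∑ v : A' × B, choi N u v *
      ∑ i, ∑ j, choi C.bipartite ((i, u.2), (u.1, i)) ((j, v.2), (v.1, j))
  have h3 : (1 / K ^ 2 * z : ℂ).re = 1 / (K : ℝ) ^ 2 * z.re := by
    rw [← Complex.re_ofReal_mul]
    push_cast
    rfl
  have h4 : (2 * (c * K - z) : ℂ).re = 2 * (c * K - z.re) := by
    simp
  have h5 := (Complex.le_def.1 hP).1
  rw [h4, Complex.zero_re] at h5
  have hK' : (0 : ℝ) < K := by exact_mod_cast hK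
  rw [h3, one_div, inv_mul_le_iff₀ (by positivity)]
  have : (K : ℝ) ^ 2 * (c / K) = c * K := by field_simp
  linarith

end ForwardAssistedCode

/-! ### Exact codes from a measurement on the Choi state -/

section Achievability

variable {A' B : Type} [Fintype A'] [DecidableEq A'] [Fintype B] [DecidableEq B] {K : ℕ}

/-- The operator `∑ i j, E i j ⊗ E i j`, an unnormalised maximally entangled state. -/
def entangledMatrix (K : ℕ) : Matrix (Fin K × Fin K) (Fin K × Fin K) ℂ :=
  Matrix.of fun x y => if x.1 = x.2 ∧ y.1 = y.2 then 1 else 0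

/-- The normalised Choi matrix `(K 1 - Φ) / (K² - 1)` of the channel that is orthogonal to the
identity. -/
noncomputable def complementMatrix (K : ℕ) : Matrix (Fin K × Fin K) (Fin K × Fin K) ℂ :=
  ((K : ℂ) ^ 2 - 1)⁻¹ • Matrix.of fun x y : Fin K × Fin K =>
    (if x = y then (K : ℂ) else 0) - if x.1 = x.2 ∧ y.1 = y.2 then 1 else 0

/-- The Choi matrix of the operation that measures `{L, 1 - L}` and applies the identity
channel or the channel orthogonal to it, according to the outcome. -/
noncomputable def measuredMatrix (K : ℕ) (L : Matrix (A' × B) (A' × B) ℂ) :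
    Matrix ((A' × B) × (Fin K × Fin K)) ((A' × B) × (Fin K × Fin K)) ℂ :=
  Matrix.of fun x y => L x.1 y.1 * entangledMatrix K x.2 y.2 +
    (1 - L) x.1 y.1 * complementMatrix K x.2 y.2

theorem natCast_sq_sub_one_pos (hK : 2 ≤ K) : 0 < (K : ℂ) ^ 2 - 1 := by
  have : (1 : ℂ) < ((K ^ 2 : ℕ) : ℂ) := by
    exact_mod_cast Nat.one_lt_pow two_ne_zero hK
  simpa using this

theorem posSemidef_measuredMatrix (hK : 2 ≤ K) {L : Matrix (A' × B) (A' × B) ℂ}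
    (h₀ : L.PosSemidef) (h₁ : (1 - L).PosSemidef) : (measuredMatrix K L).PosSemidef := by
  have hc : (complementMatrix K).PosSemidef :=
    (posSemidef_natCast_smul_one_sub K).smul (by simpa using (natCast_sq_sub_one_pos hK).le)
  have he : (entangledMatrix K).PosSemidef :=
    posSemidef_of_ite_and fun x : Fin K × Fin K => x.1 = x.2
  exact posSemidef_of_eq ((posSemidef_hadamard (h₀.submatrix Prod.fst) (he.submatrix Prod.snd)).add
    (posSemidef_hadamard (h₁.submatrix Prod.fst) (hc.submatrix Prod.snd))) fun _ _ => rfl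

theorem sum_measuredMatrix (hK : 2 ≤ K) (L : Matrix (A' × B) (A' × B) ℂ) (u v : A' × B)
    (i j : Fin K) : ∑ k, measuredMatrix K L (u, (i, k)) (v, (j, k)) =
      if u = v ∧ i = j then 1 else 0 := by
  have h := (natCast_sq_sub_one_pos hK).ne'
  have h1 : ∑ k, entangledMatrix K (i, k) (j, k) = if i = j then 1 else 0 := by
    simp [entangledMatrix, ite_and, eq_comm]
  have h2 : ∑ k, complementMatrix K (i, k) (j, k) = if i = j then 1 else 0 := by
    by_cases hij : i = j
    · simp [complementMatrix, hij, ← Finset.mul_sum]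
      rw [← sq, inv_mul_cancel₀ h]
    · have : ∀ k, ¬ (i = k ∧ j = k) := fun k hk => hij (hk.1.trans hk.2.symm)
      simp [complementMatrix, hij, this]
  simp only [measuredMatrix, Matrix.of_apply, Finset.sum_add_distrib, ← Finset.mul_sum, h1, h2]
  by_cases hij : i = j <;> simp [hij, Matrix.one_apply]

/-- Only acceptance contributes to the fidelity: the identity branch gives `K²`, the orthogonal
channel gives zero. -/
theorem sum_sum_measuredMatrix (L : Matrix (A' × B) (A' × B) ℂ) (u v : A' × B) :
    ∑ i, ∑ j, measuredMatrix K L (u, (i, i)) (v, (j, j)) = K ^ 2 * L u v := by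
  have h1 : ∑ i, ∑ j, entangledMatrix K (i, i) (j, j) = K ^ 2 := by
    simp [entangledMatrix, sq]
  have h2 : ∑ i, ∑ j, complementMatrix K (i, i) (j, j) = 0 := by
    simp [complementMatrix, ← Finset.mul_sum, Prod.ext_iff]
  simp only [measuredMatrix, Matrix.of_apply, Finset.sum_add_distrib, ← Finset.mul_sum, h1, h2]
  ring

/-- The Choi matrix of the encoder that sends the input system and one half of a maximally
entangled state through the side channel, and the other half through the channel. -/
noncomputable def entanglingEncoder (A' : Type) [Fintype A'] [DecidableEq A'] (K : ℕ) :
    Matrix (Fin K × (A' × Fin (Fintype.card (Fin K × A'))))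
      (Fin K × (A' × Fin (Fintype.card (Fin K × A')))) ℂ :=
  (Fintype.card A' : ℂ)⁻¹ • Matrix.of fun x y =>
    if Fintype.equivFin _ (x.1, x.2.1) = x.2.2 ∧ Fintype.equivFin _ (y.1, y.2.1) = y.2.2
      then 1 else 0

/-- The Choi matrix of the decoder that measures `{L, 1 - L}`. -/
noncomputable def measuringDecoder (K : ℕ) (L : Matrix (A' × B) (A' × B) ℂ) :
    Matrix ((B × Fin (Fintype.card (Fin K × A'))) × Fin K)
      ((B × Fin (Fintype.card (Fin K × A'))) × Fin K) ℂ :=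
  (measuredMatrix K L).submatrix
    (fun z => ((((Fintype.equivFin _).symm z.1.2).2, z.1.1),
      (((Fintype.equivFin (Fin K × A')).symm z.1.2).1, z.2)))
    (fun z => ((((Fintype.equivFin _).symm z.1.2).2, z.1.1),
      (((Fintype.equivFin (Fin K × A')).symm z.1.2).1, z.2)))

theorem sum_measuringDecoder_mul_entanglingEncoder (L : Matrix (A' × B) (A' × B) ℂ)
    (x y : (Fin K × B) × (A' × Fin K)) :
    ∑ q, ∑ q', measuringDecoder K L ((x.1.2, q), x.2.2) ((y.1.2, q'), y.2.2) *
      entanglingEncoder A' K (x.1.1, (x.2.1, q)) (y.1.1, (y.2.1, q')) =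
    (Fintype.card A' : ℂ)⁻¹ *
      measuredMatrix K L ((x.2.1, x.1.2), (x.1.1, x.2.2)) ((y.2.1, y.1.2), (y.1.1, y.2.2)) := by
  simp only [measuringDecoder, entanglingEncoder, Matrix.submatrix_apply, Matrix.smul_apply,
    Matrix.of_apply, smul_eq_mul, mul_ite, mul_one, mul_zero, ite_and, Finset.sum_ite_irrel,
    Finset.sum_const_zero, Finset.sum_ite_eq, Finset.mem_univ, if_true, Equiv.symm_apply_apply]
  ring

/-- The code in which Alice sends her system, together with one half of a maximally entangled
state whose other half is the channel input, to Bob, who measures `{L, 1 - L}` on the channel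
output and his half of the state and applies the identity channel or the channel orthogonal to
it, according to the outcome. -/
noncomputable def measuredCode [Nonempty A'] (hK : 2 ≤ K) (L : Matrix (A' × B) (A' × B) ℂ)
    (h₀ : L.PosSemidef) (h₁ : (1 - L).PosSemidef) : ForwardAssistedCode A' B K where
  dimQ := Fintype.card (Fin K × A')
  dimR := Fintype.card (Fin K × A')
  encoder := ofChoi (entanglingEncoder A' K)
  side := LinearMap.id
  decoder := ofChoi (measuringDecoder K L)
  encoder_isChannel := by
    rw [isChannel_iff, choi_ofChoi]
    refine ⟨(posSemidef_of_ite_and fun x : Fin K × (A' × Fin (Fintype.card (Fin K × A'))) =>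
      Fintype.equivFin _ (x.1, x.2.1) = x.2.2).smul (by simp), fun i j => ?_⟩
    by_cases hij : i = j
    · simp [entanglingEncoder, hij, Fintype.sum_prod_type]
    · have : ∀ (a : A') (q : Fin (Fintype.card (Fin K × A'))),
          ¬ (Fintype.equivFin _ (i, a) = q ∧ Fintype.equivFin _ (j, a) = q) := fun a q h =>
        hij (Prod.ext_iff.1 ((Fintype.equivFin _).injective (h.1.trans h.2.symm))).1
      simp [entanglingEncoder, hij, Fintype.sum_prod_type, this]
  side_isChannel := isChannel_id
  decoder_isChannel := by
    rw [isChannel_iff, choi_ofChoi]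
    refine ⟨(posSemidef_measuredMatrix hK h₀ h₁).submatrix _, fun i j => ?_⟩
    simp only [measuringDecoder, Matrix.submatrix_apply, sum_measuredMatrix hK]
    congr 1
    rw [eq_iff_iff, Prod.ext_iff, Prod.ext_iff,
      ← (Fintype.equivFin (Fin K × A')).symm.injective.eq_iff (a := i.2), Prod.ext_iff]
    tauto

variable [Nonempty A']

theorem comp_tensorMap_id_id {ι κ μ : Type} [Fintype ι] [DecidableEq ι] [Fintype κ]
    [DecidableEq κ] (D : OpMap (ι × κ) μ) :
    D ∘ₗ tensorMap (LinearMap.id : OpMap ι ι) (LinearMap.id : OpMap κ κ) = D := by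
  rw [tensorMap_id_id, LinearMap.comp_id]

theorem choi_bipartite_measuredCode (hK : 2 ≤ K) (L : Matrix (A' × B) (A' × B) ℂ)
    (h₀ : L.PosSemidef) (h₁ : (1 - L).PosSemidef) (x y : (Fin K × B) × (A' × Fin K)) :
    choi (measuredCode hK L h₀ h₁).bipartite x y = (Fintype.card A' : ℂ)⁻¹ *
      measuredMatrix K L ((x.2.1, x.1.2), (x.1.1, x.2.2)) ((y.2.1, y.1.2), (y.1.1, y.2.2)) := by
  have h : (measuredCode hK L h₀ h₁).receiver = (measuredCode hK L h₀ h₁).decoder :=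
    comp_tensorMap_id_id (ofChoi (measuringDecoder K L))
  rw [ForwardAssistedCode.choi_bipartite, h, ← sum_measuringDecoder_mul_entanglingEncoder]
  change ∑ q : Fin (Fintype.card (Fin K × A')), ∑ q' : Fin (Fintype.card (Fin K × A')),
    choi (ofChoi (measuringDecoder K L)) ((x.1.2, q), x.2.2) ((y.1.2, q'), y.2.2) *
      choi (ofChoi (entanglingEncoder A' K)) (x.1.1, (x.2.1, q)) (y.1.1, (y.2.1, q')) = _
  rw [choi_ofChoi, choi_ofChoi]

theorem choiPartialTranspose_measuredCode (hK : 2 ≤ K) (L : Matrix (A' × B) (A' × B) ℂ)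
    (h₀ : L.PosSemidef) (h₁ : (1 - L).PosSemidef) (x y : (Fin K × B) × (A' × Fin K)) :
    choiPartialTranspose (measuredCode hK L h₀ h₁).bipartite x y = (Fintype.card A' : ℂ)⁻¹ *
      measuredMatrix K L ((x.2.1, y.1.2), (x.1.1, y.2.2)) ((y.2.1, x.1.2), (y.1.1, x.2.2)) :=
  choi_bipartite_measuredCode hK L h₀ h₁ ((x.1.1, y.1.2), (x.2.1, y.2.2))
    ((y.1.1, x.1.2), (y.2.1, x.2.2))

/-- On the symmetric and antisymmetric spaces of `A B'`, the partial transpose of `measuredMatrix`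
is `(1 + K L^Γ)/(K + 1)` and `(1 - K L^Γ)/(K - 1)` respectively. -/
theorem isPPTPreserving_measuredCode (hK : 2 ≤ K) (L : Matrix (A' × B) (A' × B) ℂ)
    (h₀ : L.PosSemidef) (h₁ : (1 - L).PosSemidef)
    (h₂ : (1 + (K : ℂ) • partialTranspose L).PosSemidef)
    (h₃ : (1 - (K : ℂ) • partialTranspose L).PosSemidef) :
    IsPPTPreserving (measuredCode hK L h₀ h₁).bipartite := by
  apply isPPTPreserving_of_posSemidef
  let f : (Fin K × B) × (A' × Fin K) → A' × B := fun x => (x.2.1, x.1.2)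
  let g : (Fin K × B) × (A' × Fin K) → Fin K × Fin K := fun x => (x.1.1, x.2.2)
  have hF := isHermitian_swapMatrix (Fin K)
  have hF' := swapMatrix_mul_self (Fin K)
  have hp : 0 < (K : ℂ) + 1 := by positivity
  have hm : 0 < (K : ℂ) - 1 := by
    have : (1 : ℂ) < (K : ℂ) := by exact_mod_cast hK
    simpa using this
  have hT := ((posSemidef_hadamard (h₂.submatrix f)
      ((posSemidef_one_add_of_mul_self hF hF').submatrix g)).smul
        (a := (2 * ((K : ℂ) + 1))⁻¹) (by positivity)).add
    ((posSemidef_hadamard (h₃.submatrix f)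
      ((posSemidef_one_sub_of_mul_self hF hF').submatrix g)).smul
        (a := (2 * ((K : ℂ) - 1))⁻¹) (by positivity))
  have hA : 0 ≤ (Fintype.card A' : ℂ)⁻¹ := by simp
  refine posSemidef_of_eq (hT.smul hA) fun x y => ?_
  rw [choiPartialTranspose_measuredCode]
  have e1 : (1 - L) (x.2.1, y.1.2) (y.2.1, x.1.2) =
      (1 : Matrix (A' × B) (A' × B) ℂ) (f x) (f y) - partialTranspose L (f x) (f y) := by
    simp only [Matrix.sub_apply, Matrix.one_apply, Prod.ext_iff, partialTranspose,
      Matrix.of_apply, f]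
    simp only [eq_comm]
  have e2 : entangledMatrix K (x.1.1, y.2.2) (y.1.1, x.2.2) = swapMatrix (Fin K) (g x) (g y) := by
    simp only [entangledMatrix, swapMatrix, Matrix.of_apply, g]
    simp only [eq_comm]
  have e3 : complementMatrix K (x.1.1, y.2.2) (y.1.1, x.2.2) = ((K : ℂ) ^ 2 - 1)⁻¹ *
      (K * (1 : Matrix (Fin K × Fin K) (Fin K × Fin K) ℂ) (g x) (g y) -
        swapMatrix (Fin K) (g x) (g y)) := by
    rw [← e2]
    simp only [complementMatrix, entangledMatrix, Matrix.of_apply, g, Matrix.smul_apply,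
      smul_eq_mul, Matrix.one_apply, mul_ite, mul_one, mul_zero, Prod.ext_iff]
    simp only [eq_comm]
  have e4 : L (x.2.1, y.1.2) (y.2.1, x.1.2) = partialTranspose L (f x) (f y) := rfl
  have e5 : measuredMatrix K L ((x.2.1, y.1.2), (x.1.1, y.2.2)) ((y.2.1, x.1.2), (y.1.1, x.2.2)) =
      L (x.2.1, y.1.2) (y.2.1, x.1.2) * entangledMatrix K (x.1.1, y.2.2) (y.1.1, x.2.2) +
        (1 - L) (x.2.1, y.1.2) (y.2.1, x.1.2) *
          complementMatrix K (x.1.1, y.2.2) (y.1.1, x.2.2) := rfl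
  rw [e5, e1, e2, e3, e4]
  simp only [Matrix.smul_apply, smul_eq_mul,
    Matrix.add_apply, Matrix.hadamard_apply, Matrix.submatrix_apply, Matrix.sub_apply]
  have h5 := hp.ne'
  have h6 := hm.ne'
  have h7 : (K : ℂ) ^ 2 - 1 = (K + 1) * (K - 1) := by ring
  rw [h7]
  refine congrArg _ ?_
  field_simp
  ring

/-- The hypothesis `hN` says that the normalised Choi matrix of `N` is accepted with probability
one, so the identity is always applied. -/
theorem channelFidelity_measuredCode (hK : 2 ≤ K) (L : Matrix (A' × B) (A' × B) ℂ)
    (h₀ : L.PosSemidef) (h₁ : (1 - L).PosSemidef) (N : OpMap A' B)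
    (hN : ∑ u, ∑ v, choi N u v * L u v = Fintype.card A') :
    channelFidelity ((measuredCode hK L h₀ h₁).overall N) = 1 := by
  have hK' : (K : ℂ) ≠ 0 := by
    have : K ≠ 0 := by omega
    exact_mod_cast this
  have hA : (Fintype.card A' : ℂ) ≠ 0 := by simp
  rw [ForwardAssistedCode.channelFidelity_overall]
  simp only [choi_bipartite_measuredCode, ← Finset.mul_sum, sum_sum_measuredMatrix (A' := A') (B := B)]
  have : ∀ u v, choi N u v * ((Fintype.card A' : ℂ)⁻¹ * (K ^ 2 * L u v)) =
      (Fintype.card A' : ℂ)⁻¹ * K ^ 2 * (choi N u v * L u v) := fun u v => by ring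
  simp only [this, ← Finset.mul_sum, hN]
  rw [mul_right_comm, inv_mul_cancel₀ hA, one_mul, one_div,
    inv_mul_cancel₀ (pow_ne_zero 2 hK'), Complex.one_re]

theorem isGreatest_pptFidelities (hK : 2 ≤ K) (L : Matrix (A' × B) (A' × B) ℂ)
    (h₀ : L.PosSemidef) (h₁ : (1 - L).PosSemidef)
    (h₂ : (1 + (K : ℂ) • partialTranspose L).PosSemidef)
    (h₃ : (1 - (K : ℂ) • partialTranspose L).PosSemidef) {N : OpMap A' B} (hN : IsChannel N)
    (hL : ∑ u, ∑ v, choi N u v * L u v = Fintype.card A') :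
    IsGreatest (pptFidelities N K) 1 := by
  refine ⟨⟨measuredCode hK L h₀ h₁, isPPTPreserving_measuredCode hK L h₀ h₁ h₂ h₃,
    (channelFidelity_measuredCode hK L h₀ h₁ N hL).symm⟩, ?_⟩
  rintro _ ⟨C, -, rfl⟩
  exact channelFidelity_le_one (C.isChannel_overall hN)

end Achievability

/-! ### Tensor powers of bipartite matrices -/

section ProductMatrix

variable {ι κ : Type} [Fintype ι] [DecidableEq ι] [Fintype κ] [DecidableEq κ] {n : ℕ}

/-- The tensor product of a family of matrices. -/
def prodMatrix {ι : Type} {n : ℕ} (M : Fin n → Matrix ι ι ℂ) :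
    Matrix (Fin n → ι) (Fin n → ι) ℂ :=
  Matrix.of fun x y => ∏ t, M t (x t) (y t)

theorem sum_prod_eq_prod_sum {ι : Type} [Fintype ι] (f : Fin n → ι → ℂ) :
    ∑ x : Fin n → ι, ∏ t, f t (x t) = ∏ t, ∑ i, f t i := by
  classical
  rw [Finset.prod_univ_sum, Fintype.piFinset_univ]

theorem posSemidef_prodMatrix {ι : Type} [Fintype ι] {M : Fin n → Matrix ι ι ℂ}
    (hM : ∀ t, (M t).PosSemidef) : (prodMatrix M).PosSemidef := by
  suffices h : ∀ s : Finset (Fin n), (Matrix.of fun x y : Fin n → ι =>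
      ∏ t ∈ s, M t (x t) (y t)).PosSemidef from h Finset.univ
  intro s
  induction s using Finset.cons_induction with
  | empty => exact posSemidef_of_eq (posSemidef_of_mul_star fun _ => 1) fun x y => by simp
  | cons t s ht ih =>
    exact posSemidef_of_eq (posSemidef_hadamard ((hM t).submatrix fun x : Fin n → ι => x t) ih)
      fun x y => by simp [-Finset.cons_eq_insert]

/-- The tensor power of a bipartite matrix, as a bipartite matrix. -/
def tensorPower {ι κ : Type} (M : Matrix (ι × κ) (ι × κ) ℂ) (n : ℕ) :
    Matrix ((Fin n → ι) × (Fin n → κ)) ((Fin n → ι) × (Fin n → κ)) ℂ :=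
  Matrix.of fun x y => ∏ t, M (x.1 t, x.2 t) (y.1 t, y.2 t)

theorem posSemidef_tensorPower {ι κ : Type} [Fintype ι] [Fintype κ]
    {M : Matrix (ι × κ) (ι × κ) ℂ} (hM : M.PosSemidef) (n : ℕ) : (tensorPower M n).PosSemidef :=
  posSemidef_of_eq ((posSemidef_prodMatrix fun _ : Fin n => hM).submatrix
    fun x t => (x.1 t, x.2 t)) fun _ _ => rfl

theorem tensorPower_one : tensorPower (1 : Matrix (ι × κ) (ι × κ) ℂ) n = 1 := by
  ext x y
  simp only [tensorPower, Matrix.of_apply, Matrix.one_apply, Prod.ext_iff, Fintype.prod_ite_zero,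
    Finset.prod_const_one, forall_and, funext_iff]

theorem partialTranspose_tensorPower {ι κ : Type} (M : Matrix (ι × κ) (ι × κ) ℂ) :
    partialTranspose (tensorPower M n) = tensorPower (partialTranspose M) n :=
  rfl

theorem tensorPower_smul {ι κ : Type} (c : ℂ) (M : Matrix (ι × κ) (ι × κ) ℂ) :
    tensorPower (c • M) n = c ^ n • tensorPower M n := by
  ext x y
  simp [tensorPower, Finset.prod_mul_distrib]

theorem tensorPower_add_smul {ι κ : Type} (P N : Matrix (ι × κ) (ι × κ) ℂ) (s : ℂ)
    (x y : (Fin n → ι) × (Fin n → κ)) :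
    tensorPower (P + s • N) n x y = ∑ U : Finset (Fin n), s ^ (Finset.univ \ U).card *
      prodMatrix (fun t => if t ∈ U then P else N) (fun t => (x.1 t, x.2 t))
        (fun t => (y.1 t, y.2 t)) := by
  simp only [tensorPower, prodMatrix, Matrix.of_apply, Matrix.add_apply, Matrix.smul_apply,
    smul_eq_mul]
  rw [Finset.prod_add, Finset.powerset_univ]
  refine Finset.sum_congr rfl fun U _ => ?_
  rw [Finset.prod_mul_distrib, Finset.prod_const, mul_left_comm]
  congr 1
  rw [← Finset.prod_sdiff (Finset.subset_univ U), mul_comm]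
  congr 1
  · exact Finset.prod_congr rfl fun t ht => by rw [if_neg (Finset.mem_sdiff.1 ht).2]
  · exact Finset.prod_congr rfl fun t ht => by rw [if_pos ht]

/-- Expand both powers over the sets `U` of positions carrying `P`. Each product of `P`s and `N`s is
positive, with coefficient `1 + e s^k ≥ 0`, where `k` counts the positions carrying `N`. Taking `s =
-1` compares the powers of `P + N` and `P - N`; `s = 0` compares those of `P + N` and `P`. -/
theorem posSemidef_tensorPower_add_add_smul {ι κ : Type} [Fintype ι] [Fintype κ]
    {P N : Matrix (ι × κ) (ι × κ) ℂ} (hP : P.PosSemidef) (hN : N.PosSemidef) {s e : ℝ}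
    (hs : |s| ≤ 1) (he : |e| ≤ 1) (n : ℕ) :
    (tensorPower (P + N) n + (e : ℂ) • tensorPower (P + (s : ℂ) • N) n).PosSemidef := by
  have h (U : Finset (Fin n)) := (Matrix.PosSemidef.submatrix (posSemidef_prodMatrix
    (M := fun t => if t ∈ U then P else N) fun t => by split_ifs <;> assumption)
      (fun (x : (Fin n → ι) × (Fin n → κ)) t => (x.1 t, x.2 t))).smul
      (a := ((1 + e * s ^ (Finset.univ \ U).card : ℝ) : ℂ)) (by
        rw [Complex.zero_le_real]
        have h1 : |e * s ^ (Finset.univ \ U).card| ≤ 1 := by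
          rw [abs_mul, abs_pow]
          exact mul_le_one₀ he (by positivity) (pow_le_one₀ (abs_nonneg s) hs)
        linarith [(abs_le.1 h1).1])
  refine posSemidef_of_eq (Matrix.posSemidef_sum Finset.univ fun U _ => h U) fun x y => ?_
  have h1 : P + N = P + (1 : ℂ) • N := by rw [one_smul]
  rw [h1]
  simp only [Matrix.add_apply, Matrix.smul_apply, tensorPower_add_smul, smul_eq_mul,
    Matrix.sum_apply, Matrix.submatrix_apply, Finset.mul_sum, ← Finset.sum_add_distrib, one_pow]
  refine Finset.sum_congr rfl fun U _ => ?_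
  push_cast
  ring

theorem sum_tensorPower_snd {ι κ : Type} [DecidableEq ι] [Fintype κ]
    {M : Matrix (ι × κ) (ι × κ) ℂ} {c : ℂ}
    (hM : ∀ i j, ∑ k, M (i, k) (j, k) = if i = j then c else 0) (x y : Fin n → ι) :
    ∑ k, tensorPower M n (x, k) (y, k) = if x = y then c ^ n else 0 := by
  simp only [tensorPower, Matrix.of_apply]
  rw [sum_prod_eq_prod_sum fun t k => M (x t, k) (y t, k)]
  simp only [hM, Fintype.prod_ite_zero, Finset.prod_const, Finset.card_univ, Fintype.card_fin,
    funext_iff]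

theorem sum_tensorPower_mul {ι κ : Type} [Fintype ι] [Fintype κ]
    (M N : Matrix (ι × κ) (ι × κ) ℂ) :
    ∑ u, ∑ v, tensorPower M n u v * tensorPower N n u v = (∑ u, ∑ v, M u v * N u v) ^ n := by
  simp only [tensorPower, Matrix.of_apply, ← Finset.prod_mul_distrib]
  let e := Equiv.arrowProdEquivProdArrow (Fin n) (fun _ => ι) (fun _ => κ)
  rw [← e.sum_comp]
  simp_rw [← e.sum_comp (fun v => ∏ t, _)]
  change ∑ x : Fin n → ι × κ, ∑ y : Fin n → ι × κ, ∏ t, M (x t) (y t) * N (x t) (y t) = _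
  simp_rw [fun x : Fin n → ι × κ =>
    sum_prod_eq_prod_sum (fun t v => M (x t) v * N (x t) v)]
  rw [sum_prod_eq_prod_sum (fun _ u => ∑ v, M u v * N u v), Finset.prod_const, Finset.card_univ,
    Fintype.card_fin]

theorem choi_tensorPow_eq (N : OpMap ι κ) : choi (tensorPow N n) = tensorPower (choi N) n := by
  ext x y
  exact choi_tensorPow N n x y

theorem isChannel_tensorPow {N : OpMap ι κ} (hN : IsChannel N) : IsChannel (tensorPow N n) := by
  rw [isChannel_iff] at *
  rw [choi_tensorPow_eq]
  refine ⟨posSemidef_tensorPower hN.1 n, fun x y => ?_⟩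
  rw [sum_tensorPower_snd hN.2, one_pow]

end ProductMatrix

/-! ### The Werner–Holevo channel and its capacities -/

section WernerHolevo

variable {d n K : ℕ}

theorem partialTranspose_one {P Q : Type} [DecidableEq P] [DecidableEq Q] :
    partialTranspose (1 : Matrix (P × Q) (P × Q) ℂ) = 1 := by
  ext x y
  simp only [partialTranspose, Matrix.of_apply, Matrix.one_apply, Prod.ext_iff]
  simp only [eq_comm]

theorem partialTranspose_swapMatrix (d : ℕ) :
    partialTranspose (swapMatrix (Fin d)) = entangledMatrix d := by
  ext x y
  simp only [partialTranspose, Matrix.of_apply, swapMatrix, entangledMatrix]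
  simp only [eq_comm]

theorem partialTranspose_smul {P Q : Type} (c : ℂ) (X : Matrix (P × Q) (P × Q) ℂ) :
    partialTranspose (c • X) = c • partialTranspose X :=
  rfl

theorem partialTranspose_sub {P Q : Type} (X Y : Matrix (P × Q) (P × Q) ℂ) :
    partialTranspose (X - Y) = partialTranspose X - partialTranspose Y :=
  rfl

/-- The maximally entangled state of two `d`-dimensional systems, as a rank-one projection. -/
noncomputable def entangledProjection (d : ℕ) : Matrix (Fin d × Fin d) (Fin d × Fin d) ℂ :=
  (d : ℂ)⁻¹ • entangledMatrix d

theorem posSemidef_entangledProjection (d : ℕ) : (entangledProjection d).PosSemidef :=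
  (posSemidef_of_ite_and fun x : Fin d × Fin d => x.1 = x.2).smul (by simp)

theorem posSemidef_one_sub_entangledProjection (hd : 2 ≤ d) :
    (1 - entangledProjection d).PosSemidef := by
  have hd' : (d : ℂ) ≠ 0 := by
    have : d ≠ 0 := by omega
    exact_mod_cast this
  refine posSemidef_of_eq ((posSemidef_natCast_smul_one_sub d).smul (a := (d : ℂ)⁻¹) (by simp))
    fun x y => ?_
  simp only [entangledProjection, entangledMatrix, Matrix.sub_apply, Matrix.smul_apply,
    Matrix.of_apply, Matrix.one_apply, smul_eq_mul, mul_sub, mul_ite, mul_zero,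
    inv_mul_cancel₀ hd']

theorem choi_wernerHolevo (d : ℕ) :
    choi (wernerHolevo d) = (1 / ((d : ℂ) - 1)) • (1 - swapMatrix (Fin d)) := by
  ext ⟨i, k⟩ ⟨j, l⟩
  change ((1 / ((d : ℂ) - 1)) • ((Matrix.single i j (1 : ℂ)).trace •
    (1 : Matrix (Fin d) (Fin d) ℂ) - (Matrix.single i j (1 : ℂ)).transpose) :
      Matrix (Fin d) (Fin d) ℂ) k l = _
  simp only [Matrix.smul_apply, Matrix.sub_apply, smul_eq_mul, Matrix.one_apply,
    Matrix.transpose_apply, Matrix.single_apply, swapMatrix, Matrix.of_apply, Prod.ext_iff]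
  congr 2
  · by_cases h : i = j <;> simp [h]
  · simp only [eq_comm]

theorem natCast_sub_one_pos (hd : 2 ≤ d) : 0 < (d : ℂ) - 1 := by
  have : (1 : ℂ) < (d : ℂ) := by exact_mod_cast hd
  simpa using this

theorem sum_swapMatrix_snd (i j : Fin d) :
    ∑ k, swapMatrix (Fin d) (i, k) (j, k) = if i = j then 1 else 0 := by
  simp [swapMatrix, ite_and, eq_comm]

theorem sum_one_snd (i j : Fin d) :
    ∑ k, (1 : Matrix (Fin d × Fin d) (Fin d × Fin d) ℂ) (i, k) (j, k) =
      if i = j then (d : ℂ) else 0 := by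
  simp [Matrix.one_apply]

theorem isChannel_wernerHolevo (hd : 2 ≤ d) : IsChannel (wernerHolevo d) := by
  rw [isChannel_iff, choi_wernerHolevo]
  have h := natCast_sub_one_pos hd
  refine ⟨(posSemidef_one_sub_of_mul_self (isHermitian_swapMatrix _)
    (swapMatrix_mul_self _)).smul (by positivity), fun i j => ?_⟩
  simp only [Matrix.smul_apply, Matrix.sub_apply, smul_eq_mul, ← Finset.mul_sum,
    Finset.sum_sub_distrib, sum_swapMatrix_snd, sum_one_snd]
  by_cases hij : i = j
  · simp only [hij, if_true]
    exact div_mul_cancel₀ _ h.ne'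
  · simp [hij]

/-- This splits the operator into its positive and negative parts; flipping the sign of the second
gives the absolute value. -/
theorem partialTranspose_choi_wernerHolevo (hd : 2 ≤ d) :
    partialTranspose (choi (wernerHolevo d)) =
      (1 / ((d : ℂ) - 1)) • (1 - entangledProjection d) +
        ((-1 : ℝ) : ℂ) • entangledProjection d := by
  rw [choi_wernerHolevo, partialTranspose_smul, partialTranspose_sub, partialTranspose_one,
    partialTranspose_swapMatrix]
  have h := (natCast_sub_one_pos hd).ne'
  have hd' : (d : ℂ) ≠ 0 := by
    have : d ≠ 0 := by omega
    exact_mod_cast this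
  ext x y
  simp only [entangledProjection, Matrix.smul_apply, Matrix.sub_apply, Matrix.add_apply,
    smul_eq_mul]
  push_cast
  field_simp
  ring

theorem sum_abs_partialTranspose (hd : 2 ≤ d) (i j : Fin d) :
    ∑ k, ((1 / ((d : ℂ) - 1)) • (1 - entangledProjection d) + entangledProjection d)
      (i, k) (j, k) = if i = j then ((d : ℂ) + 2) / d else 0 := by
  have h := (natCast_sub_one_pos hd).ne'
  have hd' : (d : ℂ) ≠ 0 := by
    have : d ≠ 0 := by omega
    exact_mod_cast this
  have h1 : ∑ k, entangledMatrix d (i, k) (j, k) = if i = j then 1 else 0 := by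
    simp [entangledMatrix, ite_and, eq_comm]
  simp only [entangledProjection, Matrix.smul_apply, Matrix.sub_apply, Matrix.add_apply,
    smul_eq_mul, Finset.sum_add_distrib, ← Finset.mul_sum, Finset.sum_sub_distrib, h1,
    sum_one_snd]
  by_cases hij : i = j
  · simp only [hij, if_true]
    field_simp
    ring
  · simp [hij]

/-- The converse bound with `S` the tensor power of the absolute value of `J^Γ`. -/
theorem optPPTFidelity_wernerHolevo_le (hd : 2 ≤ d) (hK : 0 < K) (n : ℕ) :
    optPPTFidelity (tensorPow (wernerHolevo d) n) K ≤ (((d : ℝ) + 2) / d) ^ n / K := by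
  have : Nonempty (Fin d) := ⟨⟨0, by omega⟩⟩
  refine Real.sSup_le ?_ (by positivity)
  rintro _ ⟨C, hC, rfl⟩
  have hP : ((1 / ((d : ℂ) - 1)) • (1 - entangledProjection d)).PosSemidef :=
    (posSemidef_one_sub_entangledProjection hd).smul (by
      have := natCast_sub_one_pos hd
      positivity)
  have h (e : ℝ) (he : |e| ≤ 1) := posSemidef_tensorPower_add_add_smul hP
    (posSemidef_entangledProjection d) (s := -1) (by simp) he n
  rw [← partialTranspose_choi_wernerHolevo hd, ← partialTranspose_tensorPower,
    ← choi_tensorPow_eq] at h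
  refine C.channelFidelity_overall_le hK hC _ (tensorPower ((1 / ((d : ℂ) - 1)) •
    (1 - entangledProjection d) + entangledProjection d) n) _ ?_ ?_ fun a a' => ?_
  · have h1 := h 1 (by simp)
    rwa [Complex.ofReal_one, one_smul] at h1
  · have h1 := h (-1) (by simp)
    rwa [Complex.ofReal_neg, Complex.ofReal_one, neg_one_smul, ← sub_eq_add_neg] at h1
  · push_cast
    exact sum_tensorPower_snd (sum_abs_partialTranspose hd) a a'

/-- The measurement operator that accepts the output of the Werner–Holevo channel. -/
noncomputable def acceptMatrix (d : ℕ) : Matrix (Fin d × Fin d) (Fin d × Fin d) ℂ :=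
  ((d : ℂ) + 2)⁻¹ • ((d : ℂ) • 1 - (2 : ℂ) • swapMatrix (Fin d))

theorem posSemidef_acceptMatrix (hd : 2 ≤ d) : (acceptMatrix d).PosSemidef := by
  have h1 : (0 : ℂ) ≤ (d : ℂ) - 2 := by
    have : (2 : ℂ) ≤ (d : ℂ) := by exact_mod_cast hd
    simpa using this
  refine posSemidef_of_eq (((Matrix.PosSemidef.one.smul h1).add
    ((posSemidef_one_sub_of_mul_self (isHermitian_swapMatrix (Fin d))
      (swapMatrix_mul_self _)).smul (a := (2 : ℂ)) (by simp))).smul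
      (a := ((d : ℂ) + 2)⁻¹) (by positivity)) fun x y => ?_
  simp only [acceptMatrix, Matrix.smul_apply, Matrix.sub_apply, Matrix.add_apply, smul_eq_mul]
  ring

theorem natCast_add_two_ne_zero (d : ℕ) : (d : ℂ) + 2 ≠ 0 := by
  exact_mod_cast (Nat.succ_ne_zero (d + 1))

theorem posSemidef_one_sub_acceptMatrix (d : ℕ) : (1 - acceptMatrix d).PosSemidef := by
  refine posSemidef_of_eq ((posSemidef_one_add_of_mul_self (isHermitian_swapMatrix (Fin d))
      (swapMatrix_mul_self _)).smul (a := 2 * ((d : ℂ) + 2)⁻¹) (by positivity)) fun x y => ?_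
  have := natCast_add_two_ne_zero d
  simp only [acceptMatrix, Matrix.smul_apply, Matrix.sub_apply, Matrix.add_apply, smul_eq_mul]
  field_simp
  ring

/-- The reflection `1 - 2 Φ` has eigenvalues `±1`, so the scalar `d/(d + 2)` alone decides how large
`K` may be. -/
theorem partialTranspose_acceptMatrix (hd : 2 ≤ d) :
    partialTranspose (acceptMatrix d) = (((d : ℂ) + 2) / d)⁻¹ •
      ((1 - entangledProjection d) + ((-1 : ℝ) : ℂ) • entangledProjection d) := by
  rw [acceptMatrix, partialTranspose_smul, partialTranspose_sub, partialTranspose_smul,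
    partialTranspose_smul, partialTranspose_one, partialTranspose_swapMatrix]
  have := natCast_add_two_ne_zero d
  have hd' : (d : ℂ) ≠ 0 := by
    have : d ≠ 0 := by omega
    exact_mod_cast this
  ext x y
  simp only [entangledProjection, Matrix.smul_apply, Matrix.sub_apply, Matrix.add_apply,
    smul_eq_mul]
  push_cast
  field_simp
  ring

theorem sum_choi_wernerHolevo_mul_acceptMatrix (hd : 2 ≤ d) :
    ∑ u, ∑ v, choi (wernerHolevo d) u v * acceptMatrix d u v = d := by
  -- The three terms are the entrywise products of identity with identity, identity with swap, and
  -- swap with swap. Their sums combine to `d³ - (d + 2) d + 2 d² = d (d - 1) (d + 2)`.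
  have h1 : ∀ u v : Fin d × Fin d, choi (wernerHolevo d) u v * acceptMatrix d u v =
      (1 / ((d : ℂ) - 1)) * ((d : ℂ) + 2)⁻¹ *
        (d * (if u = v then 1 else 0) -
          (d + 2) * (if u = v ∧ u.1 = u.2 then 1 else 0) +
          2 * (if u.1 = v.2 ∧ u.2 = v.1 then 1 else 0)) := by
    intro u v
    rw [choi_wernerHolevo]
    simp only [acceptMatrix, Matrix.smul_apply, Matrix.sub_apply, smul_eq_mul, Matrix.one_apply,
      swapMatrix_apply]
    by_cases h : u = v
    · subst h
      by_cases h' : u.1 = u.2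
      · simp [h']
      · simp [h']
        ring
    · by_cases h' : u.1 = v.2 ∧ u.2 = v.1
      · simp [h, h']
        ring
      · simp [h, h']
  have h := (natCast_sub_one_pos hd).ne'
  have h' := natCast_add_two_ne_zero d
  simp only [h1, ← Finset.mul_sum, Finset.sum_add_distrib, Finset.sum_sub_distrib]
  have e1 : ∑ u : Fin d × Fin d, ∑ v, (if u = v then (1 : ℂ) else 0) = d * d := by simp
  have e2 : ∑ u : Fin d × Fin d, ∑ v, (if u = v ∧ u.1 = u.2 then (1 : ℂ) else 0) = d := by
    simp only [ite_and, Finset.sum_ite_eq, Finset.mem_univ, if_true]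
    rw [Fintype.sum_prod_type]
    simp
  have e3 : ∑ u : Fin d × Fin d, ∑ v : Fin d × Fin d,
      (if u.1 = v.2 ∧ u.2 = v.1 then (1 : ℂ) else 0) = d * d := by
    simp [ite_and, Fintype.sum_prod_type]
  rw [e1, e2, e3]
  field_simp
  ring

theorem isGreatest_pptFidelities_wernerHolevo (hd : 2 ≤ d) (hK : 2 ≤ K)
    (h : (K : ℝ) ≤ (((d : ℝ) + 2) / d) ^ n) :
    IsGreatest (pptFidelities (tensorPow (wernerHolevo d) n) K) 1 := by
  have : Nonempty (Fin d) := ⟨⟨0, by omega⟩⟩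
  have hc : (0 : ℝ) < ((d : ℝ) + 2) / d := by
    have : 0 < d := by omega
    positivity
  have hΦ (e : ℝ) (he : |e| ≤ 1) := posSemidef_tensorPower_add_add_smul
    (posSemidef_one_sub_entangledProjection hd) (posSemidef_entangledProjection d)
    (s := -1) (by simp) he n
  simp only [sub_add_cancel, tensorPower_one] at hΦ
  -- This scalar, up to sign, is the coefficient `e` for the decomposition `1 = (1 - Φ) + Φ`.
  have hK1 : |(K : ℝ) * ((((d : ℝ) + 2) / d)⁻¹) ^ n| ≤ 1 := by
    rw [abs_of_nonneg (by positivity), inv_pow, ← div_eq_mul_inv]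
    exact div_le_one_of_le₀ h (by positivity)
  have hpt : (K : ℂ) • partialTranspose (tensorPower (acceptMatrix d) n) =
      (((K : ℝ) * ((((d : ℝ) + 2) / d)⁻¹) ^ n : ℝ) : ℂ) •
        tensorPower ((1 - entangledProjection d) + ((-1 : ℝ) : ℂ) • entangledProjection d) n := by
    rw [partialTranspose_tensorPower, partialTranspose_acceptMatrix hd, tensorPower_smul, smul_smul]
    push_cast
    rfl
  refine isGreatest_pptFidelities hK (tensorPower (acceptMatrix d) n)
    (posSemidef_tensorPower (posSemidef_acceptMatrix hd) n) ?_ ?_ ?_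
    (isChannel_tensorPow (isChannel_wernerHolevo hd)) ?_
  -- With `P = L`, `N = 1 - L`, `s = 0` and `e = -1`, this is `1 - L^{⊗n} ≥ 0`.
  · have h1 := posSemidef_tensorPower_add_add_smul (posSemidef_acceptMatrix hd)
      (posSemidef_one_sub_acceptMatrix d) (s := 0) (e := -1) (by simp) (by simp) n
    simpa [tensorPower_one, sub_eq_add_neg] using h1
  · rw [hpt]
    exact hΦ _ hK1
  · rw [hpt, sub_eq_add_neg, ← neg_smul, ← Complex.ofReal_neg]
    exact hΦ _ (by rwa [abs_neg])
  · rw [choi_tensorPow_eq, sum_tensorPower_mul, sum_choi_wernerHolevo_mul_acceptMatrix hd]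
    simp

theorem optPPTFidelity_wernerHolevo_eq_one (hd : 2 ≤ d) (hK : 2 ≤ K)
    (h : (K : ℝ) ≤ (((d : ℝ) + 2) / d) ^ n) :
    optPPTFidelity (tensorPow (wernerHolevo d) n) K = 1 :=
  (isGreatest_pptFidelities_wernerHolevo hd hK h).csSup_eq

theorem one_lt_natCast_add_two_div (hd : 2 ≤ d) : 1 < ((d : ℝ) + 2) / d := by
  have : (0 : ℝ) < d := by
    have : 0 < d := by omega
    exact_mod_cast this
  rw [one_lt_div this]
  linarith

theorem eventually_two_le_floor_pow (hd : 2 ≤ d) :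
    ∀ᶠ n : ℕ in Filter.atTop, 2 ≤ ⌊(((d : ℝ) + 2) / d) ^ n⌋₊ := by
  filter_upwards [(tendsto_pow_atTop_atTop_of_one_lt
    (one_lt_natCast_add_two_div hd)).eventually_ge_atTop 2] with n hn
  exact Nat.le_floor (by exact_mod_cast hn)

theorem pptCapacity_wernerHolevo (hd : 2 ≤ d) :
    pptCapacity (wernerHolevo d) = ((Real.logb 2 (((d : ℝ) + 2) / (d : ℝ)) : ℝ) : EReal) := by
  have hc := one_lt_natCast_add_two_div hd
  have hlog : 0 < Real.logb 2 (((d : ℝ) + 2) / d) := Real.logb_pos one_lt_two hc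
  apply le_antisymm
  · refine iSup₂_le fun r hr => ?_
    rw [EReal.coe_le_coe_iff]
    by_contra! hlt
    have hr0 : 0 < r := hlog.trans hlt
    have hcr : ((d : ℝ) + 2) / d < 2 ^ r :=
      (Real.logb_lt_iff_lt_rpow one_lt_two (by linarith)).1 hlt
    have h2 : (0 : ℝ) < 2 ^ r := by positivity
    -- Above the claimed rate the fidelity bound decays geometrically, which contradicts convergence
    -- to one. The factor `2` pays for the floor, since `⌊x⌋ ≥ x / 2` for `x ≥ 1`.
    have hlim : Filter.Tendsto (fun n : ℕ => 2 * (((d : ℝ) + 2) / d / 2 ^ r) ^ n)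
        Filter.atTop (nhds 0) := by
      have := (tendsto_pow_atTop_nhds_zero_of_lt_one (r := ((d : ℝ) + 2) / d / 2 ^ r)
        (by positivity) ((div_lt_one h2).2 hcr)).const_mul 2
      simpa using this
    have hle := le_of_tendsto_of_tendsto' hr hlim fun n => by
      have h1 : (1 : ℝ) ≤ 2 ^ (r * n) := Real.one_le_rpow one_le_two (by positivity)
      have h3 : 1 ≤ ⌊(2 : ℝ) ^ (r * n)⌋₊ := Nat.le_floor (by exact_mod_cast h1)
      have h4 : (2 : ℝ) ^ (r * n) / 2 ≤ ⌊(2 : ℝ) ^ (r * n)⌋₊ := by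
        have h5 : (1 : ℝ) ≤ ⌊(2 : ℝ) ^ (r * n)⌋₊ := by exact_mod_cast h3
        linarith [Nat.lt_floor_add_one ((2 : ℝ) ^ (r * n))]
      calc
        _ ≤ (((d : ℝ) + 2) / d) ^ n / ⌊(2 : ℝ) ^ (r * n)⌋₊ :=
          optPPTFidelity_wernerHolevo_le hd h3 n
        _ ≤ (((d : ℝ) + 2) / d) ^ n / ((2 : ℝ) ^ (r * n) / 2) := by gcongr
        _ = 2 * (((d : ℝ) + 2) / d / 2 ^ r) ^ n := by
          rw [Real.rpow_mul zero_le_two, Real.rpow_natCast, div_pow (((d : ℝ) + 2) / d)]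
          field_simp
    linarith
  · refine le_iSup₂_of_le (Real.logb 2 (((d : ℝ) + 2) / d)) ?_ le_rfl
    refine tendsto_const_nhds.congr' ?_
    filter_upwards [eventually_two_le_floor_pow hd] with n hn
    rw [Real.rpow_mul zero_le_two, Real.rpow_natCast,
      Real.rpow_logb two_pos (by norm_num) (by linarith)]
    exact (optPPTFidelity_wernerHolevo_eq_one hd hn (Nat.floor_le (by positivity))).symm

theorem pptZeroErrorCapacity_wernerHolevo (hd : 2 ≤ d) :
    pptZeroErrorCapacity (wernerHolevo d) =
      ((Real.logb 2 (((d : ℝ) + 2) / (d : ℝ)) : ℝ) : EReal) := by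
  have hc := one_lt_natCast_add_two_div hd
  have hc0 : 0 < ((d : ℝ) + 2) / d := by linarith
  have hlog : 0 < Real.logb 2 (((d : ℝ) + 2) / d) := Real.logb_pos one_lt_two hc
  apply le_antisymm
  · refine iSup₂_le fun n hn => iSup₂_le fun K hK => ?_
    rw [EReal.coe_le_coe_iff]
    -- For `K = 0` the rate is zero, because `Real.logb 2 0 = 0`.
    obtain rfl | hK0 := K.eq_zero_or_pos
    · simpa using hlog.le
    have hK0' : (0 : ℝ) < K := by exact_mod_cast hK0
    have hn' : (0 : ℝ) < n := by exact_mod_cast hn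
    have h1 := optPPTFidelity_wernerHolevo_le hd hK0 n
    rw [optPPTFidelity, hK.csSup_eq, one_le_div hK0'] at h1
    rw [one_div, inv_mul_le_iff₀ hn', ← Real.logb_pow]
    exact Real.logb_le_logb_of_le one_lt_two hK0' h1
  -- Rounding `((d + 2)/d)^n` down loses at most a factor of two, hence at most `1 / n` in the rate;
  -- the supremum recovers the limit.
  · have hlim : Filter.Tendsto (fun n : ℕ => ((Real.logb 2 (((d : ℝ) + 2) / d) - 1 / n : ℝ) : EReal))
        Filter.atTop (nhds ((Real.logb 2 (((d : ℝ) + 2) / d) : ℝ) : EReal)) := by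
      refine (continuous_coe_real_ereal.tendsto _).comp ?_
      simpa using tendsto_one_div_atTop_nhds_zero_nat.const_sub (Real.logb 2 (((d : ℝ) + 2) / d))
    refine le_of_tendsto hlim ?_
    filter_upwards [eventually_two_le_floor_pow hd, Filter.eventually_ge_atTop 1] with n hn hn1
    have hn' : (0 : ℝ) < n := by exact_mod_cast hn1
    have h2 : (2 : ℝ) ≤ ⌊(((d : ℝ) + 2) / d) ^ n⌋₊ := by exact_mod_cast hn
    refine le_iSup₂_of_le n hn1 (le_iSup₂_of_le ⌊(((d : ℝ) + 2) / d) ^ n⌋₊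
      (isGreatest_pptFidelities_wernerHolevo hd hn (Nat.floor_le (by positivity))) ?_)
    rw [EReal.coe_le_coe_iff, one_div, le_inv_mul_iff₀ hn', mul_sub, mul_inv_cancel₀ hn'.ne',
      ← Real.logb_pow]
    have h3 : (((d : ℝ) + 2) / d) ^ n / 2 ≤ ⌊(((d : ℝ) + 2) / d) ^ n⌋₊ := by
      linarith [Nat.lt_floor_add_one ((((d : ℝ) + 2) / d) ^ n)]
    have h4 := Real.logb_le_logb_of_le one_lt_two (by positivity) h3
    rwa [Real.logb_div (by positivity) two_ne_zero, Real.logb_self_eq_one one_lt_two] at h4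

end WernerHolevo

end QCode

theorem mainTheorem8 (d : ℕ) (hd : 2 ≤ d) :
    QCode.pptCapacity (QCode.wernerHolevo d) =
        ((Real.logb 2 (((d : ℝ) + 2) / (d : ℝ)) : ℝ) : EReal) ∧
      QCode.pptZeroErrorCapacity (QCode.wernerHolevo d) =
        ((Real.logb 2 (((d : ℝ) + 2) / (d : ℝ)) : ℝ) : EReal) :=
  ⟨QCode.pptCapacity_wernerHolevo hd, QCode.pptZeroErrorCapacity_wernerHolevo hd⟩
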